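/- Let $X=(X_t)_{t\ge 0}$ be a real-valued Lévy process with $X_0=0$ on a probability space $(\Omega,\mathcal F,\mathbb P)$, with characteristic triplet $(\gamma,\sigma,\Pi)$, $\sigma \ge 0$, i.e. $\mathbb E[e^{i\lambda X_t}]=e^{-t\Psi(\lambda)}$ with $$\Psi(\lambda)=-i\gamma\lambda+\tfrac12\sigma^2\lambda^2+\int_{\mathbb R\setminus\{0\}}\bigl(1-e^{i\lambda z}+i\lambda z 1_{\{|z|<1\}}\bigr)\Pi(dz),\qquad \int_{\mathbb R\setminus\{0\}}(1\wedge z^2)\,\Pi(dz)<\infty .$$ Jumps of both signs are allowed. For $x\in\mathbb R$ let $\mathbb E_x$ denote expectation when $X$ is replaced by $x+X$. Assume $\int_{|z|\ge1}e^{\bar\theta|z|}\Pi(dz)<\infty$ for some $\bar\theta>0$. Let $q>0$, $\alpha>0$, $\beta\in\mathbb R$, and let $f:\mathbb R\to\mathbb R$ be convex and continuously differentiable with $|f(x)|<k_1+k_2|x|^N$ for all $x$, for some $k_1,k_2>0$ and $N\in\mathbb N$. For $b\in\mathbb R$ put $h^b(y)=\alpha 1_{(b,\infty)}(y)+\delta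 1_{\{b\}}(y)$ if $X$ has paths of bounded variation and its drift $\delta:=\gamma-\int_{(-1,1)\setminus\{0\}}z\,\Pi(dz)$ lies in $[0,\alpha]$, and $h^b(y)=\alpha1_{(b,\infty)}(y)$ otherwise. Assume that for every $b\in\mathbb R$ and every starting point of $X$ the equation $$U^b_t=X_t-\int_0^t l^b_s\,ds,\qquad l^b_t=h^b(U^b_t),\qquad t\ge0,$$ has a unique strong solution $U^b$. Set $U^{+\infty}=X$, $l^{+\infty}=0$, and $U^{-\infty}=X^{(\alpha)}:=(X_t-\alpha t)_{t\ge0}$, $l^{-\infty}=\alpha$. For $b\in[-\infty,\infty]$ define the cost function $$v_b(x)=\mathbb E_x\Bigl[\int_0^\infty e^{-qt}\bigl(f(U^b_t)+\beta l^b_t\bigr)dt\Bigr],\qquad x\in\mathbb R,$$ and let $$\rho(b)=\mathbb E_b\Bigl[\int_0^\infty e^{-qt}f'(U^b_t)\,dt\Bigr]\ (b\in\mathbb R),\qquad b^*=\inf\{b\in\mathbb R:\rho(b)-\beta\ge0\}\in[-\infty,\infty]$$ (with $\inf\emptyset=+\infty$, and $b^*=-\infty$ if $\rho(b)\ge\beta$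 for all $b\in\mathbb R$). Then $v_{b^*}$ is well defined and finite, convex and continuously differentiable on $\mathbb R$, and $$v_{b^*}'(x)=\mathbb E_x\Bigl[\int_0^\infty e^{-qt}f'(U^{b^*}_t)\,dt\Bigr],\qquad x\in\mathbb R,$$ where for every $x$ the integrands $e^{-qt}(f(U^{b^*}_t)+\beta l^{b^*}_t)$ and $e^{-qt}f'(U^{b^*}_t)$ are absolutely integrable over $\Omega\times(0,\infty)$. In particular, when $b^*=+\infty$ this holds with $U^{b^*}=X$, and when $b^*=-\infty$ it holds with $U^{b^*}=X^{(\alpha)}$. -/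

import Mathlib

open MeasureTheory ProbabilityTheory Filter Topology Set
open scoped NNReal ENNReal

namespace RefractedLevy

variable {Ω : Type*} [MeasurableSpace Ω]

/-- A real-valued Lévy process started at `0`: independent and stationary increments, and
almost surely right-continuous paths with left limits. -/
structure IsLevyProcess (X : ℝ≥0 → Ω → ℝ) (P : Measure Ω) : Prop where
  measurable : ∀ t, Measurable (X t)
  zero : ∀ᵐ ω ∂P, X 0 ω = 0
  indep_increments : HasIndepIncrements X P
  stationary_increments : ∀ s t : ℝ≥0,
    IdentDistrib (fun ω => X (s + t) ω - X s ω) (X t) P P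
  cadlag : ∀ᵐ ω ∂P, ∀ t : ℝ≥0,
    ContinuousWithinAt (fun s => X s ω) (Ici t) t ∧
      ∃ l : ℝ, Tendsto (fun s => X s ω) (𝓝[<] t) (𝓝 l)

/-- A Lévy measure on `ℝ ∖ {0}`, seen as a measure on `ℝ` that does not charge `0`. -/
structure IsLevyMeasure (ν : Measure ℝ) : Prop where
  zero : ν {0} = 0
  lintegral_lt_top : ∫⁻ z, ENNReal.ofReal (min 1 (z ^ 2)) ∂ν < ∞

open Classical in
/-- The Lévy–Khintchine exponent of the triplet `(γ, σ, ν)`. -/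
noncomputable def levyExponent (γ σ : ℝ) (ν : Measure ℝ) (u : ℝ) : ℂ :=
  -(Complex.I * γ * u) + (1 / 2 : ℂ) * σ ^ 2 * u ^ 2 +
    ∫ z : ℝ, (1 - Complex.exp (Complex.I * u * z) +
      if |z| < 1 then Complex.I * u * z else 0) ∂ν

/-- `(γ, σ, ν)` is the characteristic triplet of the process `X` under `P`. -/
structure HasLevyTriplet (X : ℝ≥0 → Ω → ℝ) (P : Measure Ω) (γ σ : ℝ) (ν : Measure ℝ) :
    Prop where
  sigma_nonneg : 0 ≤ σ
  levyMeasure : IsLevyMeasure ν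
  charFun_eq : ∀ (t : ℝ≥0) (u : ℝ),
    ∫ ω, Complex.exp (Complex.I * u * X t ω) ∂P =
      Complex.exp (-((t : ℝ) * levyExponent γ σ ν u))

/-- Almost all paths have bounded variation on every compact time interval. -/
def HasBoundedVariationPaths (X : ℝ≥0 → Ω → ℝ) (P : Measure Ω) : Prop :=
  ∀ᵐ ω ∂P, LocallyBoundedVariationOn (fun t => X t ω) univ

/-- The drift `δ = γ - ∫_{(-1,1)} z ν(dz)`, of use when the paths have bounded variation. -/
noncomputable def levyDrift (γ : ℝ) (ν : Measure ℝ) : ℝ :=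
  γ - ∫ z in Ioo (-1 : ℝ) 1, z ∂ν

/-- The paths have bounded variation and the drift lies in `[0, α]`. -/
def IsCaseTwo (X : ℝ≥0 → Ω → ℝ) (P : Measure Ω) (γ : ℝ) (ν : Measure ℝ) (α : ℝ) : Prop :=
  HasBoundedVariationPaths X P ∧ levyDrift γ ν ∈ Icc 0 α

open Classical in
/-- The feedback rate `h^b`: the maximal rate `α` above `b`, no control below `b`, and at `b`
itself the drift if `IsCaseTwo` holds and `0` otherwise. -/
noncomputable def refractionRate (X : ℝ≥0 → Ω → ℝ) (P : Measure Ω) (γ : ℝ) (ν : Measure ℝ)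
    (α b y : ℝ) : ℝ :=
  if b < y then α else if y = b ∧ IsCaseTwo X P γ ν α then levyDrift γ ν else 0

/-- The σ-algebra generated by `X` up to time `t`. -/
abbrev naturalSigma (X : ℝ≥0 → Ω → ℝ) (t : ℝ≥0) : MeasurableSpace Ω :=
  ⨆ s ≤ t, MeasurableSpace.comap (X s) inferInstance

/-- `U` is a strong solution of `U_t = x + X_t - ∫_0^t h (U_s) ds`: it solves the equation almost
surely, for all times simultaneously, and is adapted to the natural filtration of `X` (up to
null sets). -/
structure IsStrongSolution (h : ℝ → ℝ) (X : ℝ≥0 → Ω → ℝ) (P : Measure Ω) (x : ℝ)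
    (U : ℝ≥0 → Ω → ℝ) : Prop where
  adapted : ∀ t, AEStronglyMeasurable[naturalSigma X t] (U t) P
  equation : ∀ᵐ ω ∂P, ∀ t : ℝ≥0,
    U t ω = x + X t ω - ∫ s in (0 : ℝ)..t, h (U s.toNNReal ω)

/-- `U` is the unique strong solution, uniqueness being up to indistinguishability. -/
structure IsUniqueStrongSolution (h : ℝ → ℝ) (X : ℝ≥0 → Ω → ℝ) (P : Measure Ω) (x : ℝ)
    (U : ℝ≥0 → Ω → ℝ) : Prop where
  isStrongSolution : IsStrongSolution h X P x U
  unique : ∀ V : ℝ≥0 → Ω → ℝ, IsStrongSolution h X P x V → ∀ᵐ ω ∂P, ∀ t, V t ω = U t ω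

/-- `E [∫_0^∞ e^{-qt} Y_t dt]`. -/
noncomputable def discounted (P : Measure Ω) (q : ℝ) (Y : ℝ≥0 → Ω → ℝ) : ℝ :=
  ∫ ω, (∫ t in Ioi (0 : ℝ), Real.exp (-q * t) * Y t.toNNReal ω) ∂P

/-- `∫_0^∞ e^{-qt} Y_t dt` is absolutely integrable, jointly in time and chance. -/
def DiscountedIntegrable (P : Measure Ω) (q : ℝ) (Y : ℝ≥0 → Ω → ℝ) : Prop :=
  Integrable (fun p : Ω × ℝ => Real.exp (-q * p.2) * Y p.2.toNNReal p.1)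
    (P.prod (volume.restrict (Ioi (0 : ℝ))))

/-- `ρ(b) = E_b [∫_0^∞ e^{-qt} f'(U^b_t) dt]`, where `U b x` is the refracted process with
threshold `b` started at `x`. -/
noncomputable def rho (P : Measure Ω) (q : ℝ) (f : ℝ → ℝ) (U : ℝ → ℝ → ℝ≥0 → Ω → ℝ)
    (b : ℝ) : ℝ :=
  discounted P q fun t ω => deriv f (U b b t ω)

/-- `b* = inf {b ∈ ℝ : ρ(b) - β ≥ 0}`, an infimum in `[-∞, ∞]`. -/
noncomputable def bStar (P : Measure Ω) (q β : ℝ) (f : ℝ → ℝ) (U : ℝ → ℝ → ℝ≥0 → Ω → ℝ) :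
    EReal :=
  sInf ((fun b : ℝ => (b : EReal)) '' {b : ℝ | 0 ≤ rho P q f U b - β})

open Classical in
/-- The process started at `x` and controlled at the threshold `b ∈ [-∞, ∞]`: it is never
controlled if `b = ∞` and controlled at the rate `α` at all times if `b = -∞`. -/
noncomputable def controlled (X : ℝ≥0 → Ω → ℝ) (α : ℝ) (U : ℝ → ℝ → ℝ≥0 → Ω → ℝ)
    (b : EReal) (x : ℝ) (t : ℝ≥0) (ω : Ω) : ℝ :=
  if b = ⊤ then x + X t ω
  else if b = ⊥ then x + X t ω - α * t
  else U b.toReal x t ω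

open Classical in
/-- The control rate `l^b_t` of the refraction strategy at the threshold `b ∈ [-∞, ∞]`. -/
noncomputable def controlRate (X : ℝ≥0 → Ω → ℝ) (P : Measure Ω) (γ : ℝ) (ν : Measure ℝ)
    (α : ℝ) (U : ℝ → ℝ → ℝ≥0 → Ω → ℝ) (b : EReal) (x : ℝ) (t : ℝ≥0) (ω : Ω) : ℝ :=
  if b = ⊤ then 0
  else if b = ⊥ then α
  else refractionRate X P γ ν α b.toReal (U b.toReal x t ω)

/-- The running cost plus the control cost per unit of time, `f(U^b_t) + β l^b_t`. -/
noncomputable def costRate (X : ℝ≥0 → Ω → ℝ) (P : Measure Ω) (γ : ℝ) (ν : Measure ℝ)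
    (α β : ℝ) (f : ℝ → ℝ) (U : ℝ → ℝ → ℝ≥0 → Ω → ℝ) (b : EReal) (x : ℝ)
    (t : ℝ≥0) (ω : Ω) : ℝ :=
  f (controlled X α U b x t ω) + β * controlRate X P γ ν α U b x t ω

/-- The cost function `v_b(x) = E_x [∫_0^∞ e^{-qt} (f(U^b_t) + β l^b_t) dt]`. -/
noncomputable def costFunction (X : ℝ≥0 → Ω → ℝ) (P : Measure Ω) (γ : ℝ) (ν : Measure ℝ)
    (q α β : ℝ) (f : ℝ → ℝ) (U : ℝ → ℝ → ℝ≥0 → Ω → ℝ) (b : EReal) (x : ℝ) : ℝ :=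
  discounted P q (costRate X P γ ν α β f U b x)

end RefractedLevy

open RefractedLevy

/-!
The cost function `v` of the refraction strategy at `b*` is shown to satisfy, for `x < y`,
`(y - x) W(x) ≤ v(y) - v(x) ≤ (y - x) W(y)`, where `W(x)` is the expected discounted marginal cost
`E_x [∫ e^{-qt} f'(U_t) dt]`. As `W` is continuous, these bounds alone make `v` convex and
continuously differentiable with derivative `W` (`convex_contDiff_of_increment_bounds`).

If `b* = ±∞` the controlled processes started at `x` and at `y` are translates of each other, and
the bounds are the tangent inequalities of `f` (`convex_contDiff_of_constant_rate`).

Let `b*` be finite. Two refracted processes `U^x ≤ U^y` started at `x < y` have the gap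
`U^y_t - U^x_t = (y - x) - ∫_0^t m_s ds`, where `m ≥ 0` is the difference of their control rates.
By convexity `f(U^y_t) - f(U^x_t) ≥ f'(U^x_t) (U^y_t - U^x_t)`, whence
`v(y) - v(x) ≥ (y - x) W(x) - E[∫ e^{-qt} f'(U^x_t) ∫_0^t m_s ds dt] + β E[∫ e^{-qs} m_s ds]`.
It remains to see that the last two terms do not add up to a negative number. Exchange the order of
integration (`integral_mul_primitive_le`). If `m_s ≠ 0` then `U^x_s ≤ b* ≤ U^y_s`, hence, by
comparison, after time `s` the process `U^x` stays below the process that starts at `b*` at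
time `s`. The latter is driven by the increments of `X` after `s`, which are independent of `m_s`,
and its expected discounted marginal cost is `ρ(b*)`; this is `renewal_bounds`. Finally
`ρ(b*) = β`, because spatial homogeneity makes `ρ` monotone and continuous (`rho_bStar`). The upper
bound is symmetric, with `U^y` in place of `U^x`.

Two facts support this. Strong solutions are given as families of random variables, without joint
measurability in chance and time; monotonicity of the feedback rate makes an explicit time
discretization converge to every solution, path by path, so that each solution is a measurable
functional `flow` of the driving path (`SolvesODE.eq_flow`). Comparison, and hence the coupling of
different starting points, comes with it. Integrability comes from moments of `X` at an independent
exponential time: its characteristic function there is `q / (q + Ψ)`, which is smooth, and a finite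
measure with smooth characteristic function has all its moments
(`integrable_even_pow_of_contDiff_charFun`).
-/

namespace RefractedLevy

/-! ### Independence and stationarity of the shifted process -/

section

/-- A finite set of times is contained in the range of a monotone sequence of its elements. -/
lemma exists_monotone_enumeration {ι : Type*} [LinearOrder ι] (A : Finset ι) (hA : A.Nonempty) :
    ∃ t : ℕ → ι, Monotone t ∧ ∀ a ∈ A, ∃ k, t k = a := by
  have hc : 0 < A.card := hA.card_pos
  refine ⟨fun k => A.orderEmbOfFin rfl ⟨min k (A.card - 1), by omega⟩, ?_, ?_⟩
  · intro i j hij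
    apply (A.orderEmbOfFin rfl).monotone
    simp only [Fin.mk_le_mk]
    omega
  · intro a ha
    have : a ∈ Set.range (A.orderEmbOfFin rfl) := by simpa using ha
    obtain ⟨k, hk⟩ := this
    refine ⟨k, ?_⟩
    rw [← hk]
    have := k.2
    exact congrArg _ (Fin.ext (by simp only; omega))

variable {Ω : Type*} [MeasurableSpace Ω]

/-- The Lévy process observed from time `s` on, re-started at `0`. -/
def shifted (X : ℝ≥0 → Ω → ℝ) (s : ℝ≥0) (u : ℝ≥0) (ω : Ω) : ℝ := X (s + u) ω - X s ω

lemma IsLevyProcess.measurable_shifted {X : ℝ≥0 → Ω → ℝ} {P : Measure Ω}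
    (hX : IsLevyProcess X P) (s : ℝ≥0) (u : ℝ≥0) : Measurable (shifted X s u) :=
  (hX.measurable _).sub (hX.measurable _)

/-- The past up to time `s` is independent of the shifted process. -/
lemma IsLevyProcess.indepFun_shifted {X : ℝ≥0 → Ω → ℝ} {P : Measure Ω} [IsProbabilityMeasure P]
    (hX : IsLevyProcess X P) (s : ℝ≥0) :
    IndepFun (fun ω (r : Iic s) => X r ω) (fun ω u => shifted X s u ω) P := by
  classical
  refine IndepFun.process_indepFun_process (fun r => hX.measurable _)
    (fun u => hX.measurable_shifted s u) fun I J => ?_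
  let A : Finset ℝ≥0 := insert 0 (insert s
    (I.image (fun r : Iic s => (r : ℝ≥0)) ∪ J.image (fun u => s + u)))
  obtain ⟨t, hmono, hsurj⟩ := exists_monotone_enumeration A ⟨0, by simp [A]⟩
  have ht0 : t 0 = 0 := by
    obtain ⟨k, hk⟩ := hsurj 0 (by simp [A])
    exact le_antisymm (hk ▸ hmono (Nat.zero_le k)) zero_le
  obtain ⟨i₀, hi₀⟩ := hsurj s (by simp [A])
  have hpast : ∀ r : I, ∃ k, k ≤ i₀ ∧ t k = r := by
    intro r
    obtain ⟨k, hk⟩ := hsurj r (by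
      have : ((r : Iic s) : ℝ≥0) ∈ I.image (fun r : Iic s => (r : ℝ≥0)) :=
        Finset.mem_image_of_mem _ r.2
      exact Finset.mem_insert_of_mem (Finset.mem_insert_of_mem (Finset.mem_union_left _ this)))
    rcases le_total k i₀ with h | h
    · exact ⟨k, h, hk⟩
    · refine ⟨i₀, le_rfl, le_antisymm ?_ ?_⟩
      · rw [← hk]; exact hmono h
      · rw [hi₀]; exact r.1.2
  have hfut : ∀ u : J, ∃ k, i₀ ≤ k ∧ t k = s + u := by
    intro u
    obtain ⟨k, hk⟩ := hsurj (s + u) (by simp [A])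
    rcases le_total i₀ k with h | h
    · exact ⟨k, h, hk⟩
    · refine ⟨i₀, le_rfl, le_antisymm ?_ ?_⟩
      · rw [hi₀]; exact le_self_add
      · rw [← hk]; exact hmono h
  choose kp hkp1 hkp2 using hpast
  choose kf hkf1 hkf2 using hfut
  let n : ℕ := i₀ + 1 + ∑ u : J, kf u
  have hn : ∀ u : J, kf u ≤ n := fun u => by
    have := Finset.single_le_sum (f := kf) (fun _ _ => Nat.zero_le _) (Finset.mem_univ u)
    omega
  -- Values of the past and of the shifted process are sums of increments over disjoint ranges.
  have hind := (hX.indep_increments.nat hmono).indepFun_finset (Finset.range i₀) (Finset.Ico i₀ n)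
    (by
      rw [Finset.disjoint_left]
      intro a ha hb
      simp at ha hb
      omega)
    (fun i => (hX.measurable _).sub (hX.measurable _))
  let φ : ({i // i ∈ Finset.range i₀} → ℝ) → (I → ℝ) := fun v r =>
    ∑ i : {i // i ∈ Finset.range i₀}, if (i : ℕ) < kp r then v i else 0
  let ψ : ({i // i ∈ Finset.Ico i₀ n} → ℝ) → (J → ℝ) := fun v u =>
    ∑ i : {i // i ∈ Finset.Ico i₀ n}, if (i : ℕ) < kf u then v i else 0
  have hφ : Measurable φ := by
    refine measurable_pi_lambda _ fun r => Finset.measurable_sum _ fun i _ => ?_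
    split_ifs
    · exact measurable_pi_apply _
    · exact measurable_const
  have hψ : Measurable ψ := by
    refine measurable_pi_lambda _ fun r => Finset.measurable_sum _ fun i _ => ?_
    split_ifs
    · exact measurable_pi_apply _
    · exact measurable_const
  refine (hind.comp hφ hψ).congr ?_ ?_
  · filter_upwards [hX.zero] with ω hω
    funext r
    simp only [φ, Function.comp]
    rw [Finset.sum_coe_sort (Finset.range i₀)
      (fun i => if i < kp r then X (t (i + 1)) ω - X (t i) ω else 0), ← Finset.sum_filter]
    have : (Finset.range i₀).filter (fun i => i < kp r) = Finset.range (kp r) := by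
      ext i; have := hkp1 r; simp; omega
    rw [this, Finset.sum_range_sub (fun i => X (t i) ω), ht0, hω, hkp2, sub_zero]
  · refine Eventually.of_forall fun ω => ?_
    funext u
    simp only [ψ, Function.comp]
    rw [Finset.sum_coe_sort (Finset.Ico i₀ n)
      (fun i => if i < kf u then X (t (i + 1)) ω - X (t i) ω else 0), ← Finset.sum_filter]
    have : (Finset.Ico i₀ n).filter (fun i => i < kf u) = Finset.Ico i₀ (kf u) := by
      ext i; have := hn u; simp; omega
    rw [this, Finset.sum_Ico_sub (fun i => X (t i) ω) (hkf1 u), hi₀, hkf2, shifted]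

/-- The shifted process has the law of the Lévy process. -/
lemma IsLevyProcess.identDistrib_shifted {X : ℝ≥0 → Ω → ℝ} {P : Measure Ω}
    [IsProbabilityMeasure P] (hX : IsLevyProcess X P) (s : ℝ≥0) :
    IdentDistrib (fun ω u => shifted X s u ω) (fun ω u => X u ω) P P := by
  classical
  rw [identDistrib_iff_forall_finset_identDistrib
    (measurable_pi_lambda _ fun u => hX.measurable_shifted s u).aemeasurable
    (measurable_pi_lambda _ fun u => hX.measurable u).aemeasurable]
  intro J
  obtain ⟨t, hmono, hsurj⟩ := exists_monotone_enumeration (insert 0 J) ⟨0, by simp⟩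
  have ht0 : t 0 = 0 := by
    obtain ⟨k, hk⟩ := hsurj 0 (by simp)
    exact le_antisymm (hk ▸ hmono (Nat.zero_le k)) zero_le
  have hk : ∀ u : J, ∃ k, t k = u := fun u => hsurj u (by simp)
  choose k hk using hk
  have hmono' : Monotone fun i => s + t i := fun i j hij => add_le_add_right (hmono hij) s
  have key := IdentDistrib.pi (μ := P) (ν := P)
    (X := fun i ω => X (s + t (i + 1)) ω - X (s + t i) ω)
    (Y := fun i ω => X (t (i + 1)) ω - X (t i) ω)
    (fun i => by
      have h1 := hX.stationary_increments (s + t i) (t (i + 1) - t i)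
      have h2 := hX.stationary_increments (t i) (t (i + 1) - t i)
      have e : t i + (t (i + 1) - t i) = t (i + 1) := add_tsub_cancel_of_le (hmono (Nat.le_succ i))
      rw [add_assoc, e] at h1
      rw [e] at h2
      exact h1.trans h2.symm)
    (hX.indep_increments.nat hmono') (hX.indep_increments.nat hmono)
  let φ : (ℕ → ℝ) → (J → ℝ) := fun v u => ∑ i ∈ Finset.range (k u), v i
  have hφ : Measurable φ := by
    refine measurable_pi_lambda _ fun r => Finset.measurable_sum _ fun i _ => measurable_pi_apply _
  have h := key.comp hφ
  have e1 : (φ ∘ fun ω i => X (s + t (i + 1)) ω - X (s + t i) ω) =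
      fun ω => J.restrict (fun u => shifted X s u ω) := by
    funext ω u
    simp only [φ, Function.comp, Finset.restrict]
    rw [Finset.sum_range_sub (fun i => X (s + t i) ω), ht0, hk, add_zero, shifted]
  have e2 : (φ ∘ fun ω i => X (t (i + 1)) ω - X (t i) ω) =ᵐ[P]
      fun ω => J.restrict (fun u => X u ω) := by
    filter_upwards [hX.zero] with ω hω
    funext u
    simp only [φ, Function.comp, Finset.restrict]
    rw [Finset.sum_range_sub (fun i => X (t i) ω), ht0, hk, hω, sub_zero]
  rw [← e1]
  exact h.trans (IdentDistrib.of_ae_eq h.aemeasurable_snd e2)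

end

/-! ### The refracted path as a measurable functional of the driving path -/

section

/-- The path `p` recovered from its values at rational times. It agrees with `p` wherever `p` is
right-continuous, and it depends measurably on time and on `p` jointly for the product
`σ`-algebra on paths. -/
noncomputable def regularize (p : ℝ≥0 → ℝ) (s : ℝ) : ℝ :=
  limsup (fun n : ℕ => p (((⌊s * (n + 1)⌋₊ : ℝ≥0) + 1) / ((n : ℝ≥0) + 1))) atTop

lemma measurable_comp_floor {β : Type*} [MeasurableSpace β] {F : β → ℕ → ℝ}
    (hF : ∀ j, Measurable fun b => F b j) (c : ℝ) :
    Measurable fun a : β × ℝ => F a.1 ⌊a.2 * c⌋₊ := by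
  have h1 : Measurable fun a : β × ℕ => F a.1 a.2 :=
    measurable_from_prod_countable_left hF
  exact h1.comp (measurable_fst.prodMk (Nat.measurable_floor.comp (measurable_snd.mul_const _)))

lemma measurable_regularize : Measurable fun a : (ℝ≥0 → ℝ) × ℝ => regularize a.1 a.2 := by
  refine Measurable.limsup fun n => ?_
  exact measurable_comp_floor (F := fun (p : ℝ≥0 → ℝ) (j : ℕ) =>
    p (((j : ℝ≥0) + 1) / ((n : ℝ≥0) + 1))) (fun j => measurable_pi_apply _) _

lemma regularize_eq {p : ℝ≥0 → ℝ} {s : ℝ} (hs : 0 ≤ s)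
    (hp : ContinuousWithinAt p (Ici s.toNNReal) s.toNNReal) :
    regularize p s = p s.toNNReal := by
  refine Tendsto.limsup_eq ?_
  refine hp.tendsto.comp ?_
  rw [tendsto_nhdsWithin_iff]
  have hpos : ∀ n : ℕ, (0 : ℝ) < n + 1 := fun n => by positivity
  constructor
  · rw [← NNReal.tendsto_coe]
    push_cast
    rw [Real.coe_toNNReal _ hs]
    refine tendsto_of_tendsto_of_tendsto_of_le_of_le (g := fun _ => s)
      (h := fun n : ℕ => s + 1 / ((n : ℝ) + 1)) tendsto_const_nhds ?_ ?_ ?_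
    · simpa using tendsto_const_nhds.add (tendsto_one_div_add_atTop_nhds_zero_nat (𝕜 := ℝ))
    · intro n
      show s ≤ _
      rw [le_div_iff₀ (hpos n)]
      exact (Nat.lt_floor_add_one _).le
    · intro n
      show _ ≤ s + _
      rw [div_le_iff₀ (hpos n), add_mul, one_div, inv_mul_cancel₀ (hpos n).ne']
      have := Nat.floor_le (mul_nonneg hs (hpos n).le)
      linarith
  · refine Eventually.of_forall fun n => ?_
    show s.toNNReal ≤ _
    rw [← NNReal.coe_le_coe, Real.coe_toNNReal _ hs]
    push_cast
    rw [le_div_iff₀ (hpos n)]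
    exact (Nat.lt_floor_add_one _).le

/-- The explicit scheme of step `1 / (k + 1)` for `y' = -h (g + y)`, `y 0 = x`: over each step the
unknown `y` is frozen inside `h` while the driving path `g` is not. The error of the scheme is thus
governed by the bound on `h` alone, whatever the regularity of `g`. -/
noncomputable def scheme (h : ℝ → ℝ) (x : ℝ) (g : ℝ → ℝ) (k : ℕ) : ℕ → ℝ
  | 0 => x
  | j + 1 => scheme h x g k j -
      ∫ s in (j / (k + 1) : ℝ)..((j + 1) / (k + 1)), h (g s + scheme h x g k j)

/-- The limit of the schemes, added to the driving path. -/
noncomputable def flow (h : ℝ → ℝ) (x : ℝ) (g : ℝ → ℝ) (t : ℝ) : ℝ :=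
  g t + limsup (fun k : ℕ => scheme h x g k ⌊t * (k + 1)⌋₊) atTop

/-- A monotone feedback rate with values in `[0, α]`. -/
structure IsRate (h : ℝ → ℝ) (α : ℝ) : Prop where
  mono : Monotone h
  nonneg : ∀ y, 0 ≤ h y
  le : ∀ y, h y ≤ α

lemma measurable_scheme {h : ℝ → ℝ} {α : ℝ} (hh : IsRate h α) (x : ℝ) (k j : ℕ) :
    Measurable fun p : ℝ≥0 → ℝ => scheme h x (regularize p) k j := by
  induction j with
  | zero => exact measurable_const
  | succ j ih =>
    simp only [scheme]
    refine ih.sub ?_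
    have hle : (j / (k + 1) : ℝ) ≤ ((j + 1) / (k + 1)) := by gcongr; linarith
    simp only [intervalIntegral.integral_of_le hle]
    refine StronglyMeasurable.measurable ?_
    refine StronglyMeasurable.integral_prod_right (f := fun (p : ℝ≥0 → ℝ) (s : ℝ) =>
      h (regularize p s + scheme h x (regularize p) k j)) ?_
    refine Measurable.stronglyMeasurable ?_
    exact hh.mono.measurable.comp (measurable_regularize.add (ih.comp measurable_fst))

lemma measurable_flow {h : ℝ → ℝ} {α : ℝ} (hh : IsRate h α) (x : ℝ) :
    Measurable fun a : (ℝ≥0 → ℝ) × ℝ => flow h x (regularize a.1) a.2 := by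
  unfold flow
  exact measurable_regularize.add (Measurable.limsup fun k =>
    measurable_comp_floor (measurable_scheme hh x k) _)

lemma IsRate.bound_nonneg {h : ℝ → ℝ} {α : ℝ} (hh : IsRate h α) : 0 ≤ α :=
  (hh.nonneg 0).trans (hh.le 0)

lemma IsRate.intervalIntegrable {h : ℝ → ℝ} {α : ℝ} (hh : IsRate h α) {g : ℝ → ℝ}
    (hg : Measurable g) (a b : ℝ) : IntervalIntegrable (fun s => h (g s)) volume a b := by
  refine (intervalIntegrable_const (c := α)).mono_fun
    (hh.mono.measurable.comp hg).aestronglyMeasurable (Eventually.of_forall fun s => ?_)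
  show ‖h (g s)‖ ≤ ‖α‖
  rw [Real.norm_of_nonneg (hh.nonneg _), Real.norm_of_nonneg hh.bound_nonneg]
  exact hh.le _

/-- `y` solves `y' = -h (g + y)` in integrated form on `[0, ∞)`. -/
structure SolvesODE (h : ℝ → ℝ) (g y : ℝ → ℝ) : Prop where
  integrable : ∀ a b, 0 ≤ a → 0 ≤ b → IntervalIntegrable (fun s => h (g s + y s)) volume a b
  eq : ∀ a b, 0 ≤ a → a ≤ b → y b = y a - ∫ s in a..b, h (g s + y s)

namespace SolvesODE
variable {h : ℝ → ℝ} {α : ℝ} {g y : ℝ → ℝ}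

lemma antitone (hy : SolvesODE h g y) (hh : IsRate h α) {a b : ℝ} (ha : 0 ≤ a) (hab : a ≤ b) :
    y b ≤ y a := by
  rw [hy.eq a b ha hab]
  have := intervalIntegral.integral_nonneg (μ := volume) hab
    (f := fun s => h (g s + y s)) fun s _ => hh.nonneg _
  linarith

lemma le_add (hy : SolvesODE h g y) (hh : IsRate h α) {a b : ℝ} (ha : 0 ≤ a) (hab : a ≤ b) :
    y a ≤ y b + α * (b - a) := by
  rw [hy.eq a b ha hab]
  have := intervalIntegral.integral_mono_on (μ := volume) hab
    (hy.integrable a b ha (ha.trans hab)) (intervalIntegrable_const (c := α)) fun s _ => hh.le _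
  rw [intervalIntegral.integral_const, smul_eq_mul, mul_comm] at this
  linarith

end SolvesODE

lemma integral_rate_mem {h : ℝ → ℝ} {α : ℝ} (hh : IsRate h α) {g : ℝ → ℝ}
    (hg : Measurable g) {a b : ℝ} (hab : a ≤ b) :
    0 ≤ ∫ s in a..b, h (g s) ∧ ∫ s in a..b, h (g s) ≤ α * (b - a) := by
  constructor
  · exact intervalIntegral.integral_nonneg hab fun s _ => hh.nonneg _
  · have := intervalIntegral.integral_mono_on (μ := volume) hab
      (hh.intervalIntegrable hg a b) (intervalIntegrable_const (c := α)) fun s _ => hh.le _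
    rwa [intervalIntegral.integral_const, smul_eq_mul, mul_comm] at this

lemma step_sub (k j : ℕ) : ((j + 1) / (k + 1) : ℝ) - j / (k + 1) = 1 / (k + 1) := by
  rw [← sub_div]; congr 1; ring

/-- A solution that starts below the scheme stays below it, up to two steps' worth of control. If
the solution exceeds the scheme by at least one step's worth of control, it stays above the frozen
value during the whole step and therefore decreases faster than the scheme. -/
lemma SolvesODE.le_scheme {h : ℝ → ℝ} {α : ℝ} {g y : ℝ → ℝ} (hy : SolvesODE h g y)
    (hh : IsRate h α) (hg : Measurable g) {x : ℝ} (hx : y 0 ≤ x) (k j : ℕ) :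
    y (j / (k + 1)) ≤ scheme h x g k j + 2 * (α * (1 / (k + 1))) := by
  have hc : 0 ≤ α * (1 / ((k : ℝ) + 1)) := mul_nonneg hh.bound_nonneg (by positivity)
  induction j with
  | zero => simp only [scheme, CharP.cast_eq_zero, zero_div]; linarith
  | succ j ih =>
    have ha : (0 : ℝ) ≤ j / (k + 1) := by positivity
    have hab : (j / (k + 1) : ℝ) ≤ (j + 1) / (k + 1) := by gcongr; linarith
    simp only [scheme]
    push_cast
    rw [hy.eq _ _ ha hab]
    have hgz : Measurable fun s => g s + scheme h x g k j := hg.add_const _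
    by_cases hcase : y (j / (k + 1)) ≤ scheme h x g k j + α * (1 / (k + 1))
    · have h1 := (integral_rate_mem hh hgz hab).2
      rw [step_sub] at h1
      have h2 := intervalIntegral.integral_nonneg (μ := volume) hab
        (f := fun s => h (g s + y s)) fun s _ => hh.nonneg _
      linarith
    · have : ∫ s in (j / (k + 1) : ℝ)..((j + 1) / (k + 1)), h (g s + scheme h x g k j) ≤
          ∫ s in (j / (k + 1) : ℝ)..((j + 1) / (k + 1)), h (g s + y s) := by
        refine intervalIntegral.integral_mono_on hab (hh.intervalIntegrable hgz _ _)
          (hy.integrable _ _ ha (ha.trans hab)) fun s hs => hh.mono ?_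
        have h3 := hy.le_add hh ha hs.1
        have h4 : α * (s - j / (k + 1)) ≤ α * (1 / (k + 1)) := by
          rw [← step_sub k j]
          exact mul_le_mul_of_nonneg_left (by linarith [hs.2]) hh.bound_nonneg
        linarith
      linarith

/-- A solution that starts above the scheme stays above it, up to one step's worth of control. -/
lemma SolvesODE.scheme_le {h : ℝ → ℝ} {α : ℝ} {g y : ℝ → ℝ} (hy : SolvesODE h g y)
    (hh : IsRate h α) (hg : Measurable g) {x : ℝ} (hx : x ≤ y 0) (k j : ℕ) :
    scheme h x g k j ≤ y (j / (k + 1)) + α * (1 / (k + 1)) := by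
  have hc : 0 ≤ α * (1 / ((k : ℝ) + 1)) := mul_nonneg hh.bound_nonneg (by positivity)
  induction j with
  | zero => simp only [scheme, CharP.cast_eq_zero, zero_div]; linarith
  | succ j ih =>
    have ha : (0 : ℝ) ≤ j / (k + 1) := by positivity
    have hab : (j / (k + 1) : ℝ) ≤ (j + 1) / (k + 1) := by gcongr; linarith
    have hgz : Measurable fun s => g s + scheme h x g k j := hg.add_const _
    by_cases hcase : scheme h x g k j ≤ y (j / (k + 1))
    · have h1 := hy.le_add hh ha hab
      rw [step_sub] at h1
      have h2 := (integral_rate_mem hh hgz hab).1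
      simp only [scheme]
      push_cast
      linarith
    · have : ∫ s in (j / (k + 1) : ℝ)..((j + 1) / (k + 1)), h (g s + y s) ≤
          ∫ s in (j / (k + 1) : ℝ)..((j + 1) / (k + 1)), h (g s + scheme h x g k j) := by
        refine intervalIntegral.integral_mono_on hab (hy.integrable _ _ ha (ha.trans hab))
          (hh.intervalIntegrable hgz _ _) fun s hs => hh.mono ?_
        have h3 := hy.antitone hh ha hs.1
        linarith
      simp only [scheme]
      push_cast
      rw [hy.eq _ _ ha hab]
      linarith

lemma scheme_mem {h : ℝ → ℝ} {α : ℝ} {g : ℝ → ℝ} (hh : IsRate h α) (hg : Measurable g) (x : ℝ)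
    (k j : ℕ) : scheme h x g k j ≤ x ∧ x - α * (j / (k + 1)) ≤ scheme h x g k j := by
  induction j with
  | zero => simp [scheme]
  | succ j ih =>
    have hab : (j / (k + 1) : ℝ) ≤ (j + 1) / (k + 1) := by gcongr; linarith
    have h1 := integral_rate_mem hh (hg.add_const (scheme h x g k j)) hab
    have h2 : α * ((j + 1) / (k + 1)) = α * (j / (k + 1)) + α * ((j + 1) / (k + 1) - j / (k + 1)) :=
      by ring
    simp only [scheme]
    push_cast
    rw [h2]
    constructor <;> linarith [h1.1, h1.2, ih.1, ih.2]

lemma floor_div_mem {t : ℝ} (ht : 0 ≤ t) (k : ℕ) :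
    (⌊t * (k + 1)⌋₊ / (k + 1) : ℝ) ≤ t ∧ t ≤ ⌊t * (k + 1)⌋₊ / (k + 1) + 1 / (k + 1) := by
  have hpos : (0 : ℝ) < k + 1 := by positivity
  constructor
  · rw [div_le_iff₀ hpos]
    exact Nat.floor_le (by positivity)
  · rw [← add_div, le_div_iff₀ hpos]
    exact (Nat.lt_floor_add_one _).le

lemma scheme_floor_bdd {h : ℝ → ℝ} {α : ℝ} {g : ℝ → ℝ} (hh : IsRate h α) (hg : Measurable g)
    (x : ℝ) {t : ℝ} (ht : 0 ≤ t) (k : ℕ) :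
    scheme h x g k ⌊t * (k + 1)⌋₊ ≤ x ∧ x - α * t ≤ scheme h x g k ⌊t * (k + 1)⌋₊ := by
  have h1 := scheme_mem hh hg x k ⌊t * (k + 1)⌋₊
  refine ⟨h1.1, le_trans ?_ h1.2⟩
  have := mul_le_mul_of_nonneg_left (floor_div_mem ht k).1 hh.bound_nonneg
  linarith

lemma tendsto_add_mul_one_div (a c : ℝ) :
    Tendsto (fun k : ℕ => a + c * (1 / ((k : ℝ) + 1))) atTop (𝓝 a) := by
  simpa using tendsto_const_nhds.add
    ((tendsto_one_div_add_atTop_nhds_zero_nat (𝕜 := ℝ)).const_mul c)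

/-- Comparison of a solution with the flow started above it. -/
lemma SolvesODE.le_flow {h : ℝ → ℝ} {α : ℝ} {g y : ℝ → ℝ} (hy : SolvesODE h g y)
    (hh : IsRate h α) (hg : Measurable g) {x : ℝ} (hx : y 0 ≤ x) {t : ℝ} (ht : 0 ≤ t) :
    g t + y t ≤ flow h x g t := by
  refine add_le_add_right ?_ _
  have hlim := tendsto_add_mul_one_div (y t) (-(2 * α))
  rw [← hlim.limsup_eq]
  refine limsup_le_limsup (Eventually.of_forall fun k => ?_) ?_ ?_
  · have h1 := hy.le_scheme hh hg hx k ⌊t * (k + 1)⌋₊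
    have h2 := hy.antitone hh (a := ⌊t * (k + 1)⌋₊ / (k + 1)) (by positivity) (floor_div_mem ht k).1
    show _ ≤ scheme h x g k ⌊t * (k + 1)⌋₊
    linarith
  · exact hlim.isBoundedUnder_ge.isCoboundedUnder_le
  · exact isBoundedUnder_of ⟨x, fun k => (scheme_floor_bdd hh hg x ht k).1⟩

/-- Comparison of a solution with the flow started below it. -/
lemma SolvesODE.flow_le {h : ℝ → ℝ} {α : ℝ} {g y : ℝ → ℝ} (hy : SolvesODE h g y)
    (hh : IsRate h α) (hg : Measurable g) {x : ℝ} (hx : x ≤ y 0) {t : ℝ} (ht : 0 ≤ t) :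
    flow h x g t ≤ g t + y t := by
  refine add_le_add_right ?_ _
  have hlim := tendsto_add_mul_one_div (y t) (2 * α)
  rw [← hlim.limsup_eq]
  refine limsup_le_limsup (Eventually.of_forall fun k => ?_) ?_ ?_
  · have h1 := hy.scheme_le hh hg hx k ⌊t * (k + 1)⌋₊
    have h2 := hy.le_add hh (a := ⌊t * (k + 1)⌋₊ / (k + 1)) (by positivity) (floor_div_mem ht k).1
    have h3 : α * (t - ⌊t * (k + 1)⌋₊ / (k + 1)) ≤ α * (1 / (k + 1)) :=
      mul_le_mul_of_nonneg_left (by linarith [(floor_div_mem ht k).2]) hh.bound_nonneg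
    show scheme h x g k ⌊t * (k + 1)⌋₊ ≤ _
    linarith
  · exact (isBoundedUnder_of ⟨x - α * t, fun k => (scheme_floor_bdd hh hg x ht k).2⟩ :
      IsBoundedUnder (· ≥ ·) atTop _).isCoboundedUnder_le
  · exact hlim.isBoundedUnder_le

lemma SolvesODE.eq_flow {h : ℝ → ℝ} {α : ℝ} {g y : ℝ → ℝ} (hy : SolvesODE h g y)
    (hh : IsRate h α) (hg : Measurable g) {t : ℝ} (ht : 0 ≤ t) :
    g t + y t = flow h (y 0) g t :=
  le_antisymm (hy.le_flow hh hg le_rfl ht) (hy.flow_le hh hg le_rfl ht)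

/-- The integral equation forces the integrability of the feedback rate: past the first time at
which integrability fails the integral takes the value `0`, so that the solution is
a translate of the driving path there and the rate is measurable after all. -/
lemma intervalIntegrable_of_integral_equation {h : ℝ → ℝ} {α : ℝ} (hh : IsRate h α)
    {g u : ℝ → ℝ} (hg : Measurable g) (x : ℝ)
    (hu : ∀ t, 0 ≤ t → u t = x + g t - ∫ s in (0 : ℝ)..t, h (u s)) {t : ℝ} (ht : 0 ≤ t) :
    IntervalIntegrable (fun s => h (u s)) volume 0 t := by
  -- The rate is bounded, so that only its measurability is at stake.
  have of_meas : ∀ r, 0 ≤ r →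
      AEStronglyMeasurable (fun s => h (u s)) (volume.restrict (Ioc 0 r)) →
      IntervalIntegrable (fun s => h (u s)) volume 0 r := by
    intro r hr hm
    rw [intervalIntegrable_iff_integrableOn_Ioc_of_le hr]
    refine Integrable.mono' (g := fun _ => α) (integrable_const _) hm
      (Eventually.of_forall fun s => ?_)
    rw [Real.norm_of_nonneg (hh.nonneg _)]
    exact hh.le _
  by_contra hcon
  set T : Set ℝ := {r | 0 ≤ r ∧ ¬ IntervalIntegrable (fun s => h (u s)) volume 0 r} with hT
  have htT : t ∈ T := ⟨ht, hcon⟩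
  have hbdd : BddBelow T := ⟨0, fun r hr => hr.1⟩
  have hup : ∀ r ∈ T, ∀ r', r ≤ r' → r' ∈ T := by
    intro r hr r' hrr'
    refine ⟨hr.1.trans hrr', fun hi => hr.2 (hi.mono_set ?_)⟩
    rw [uIcc_of_le hr.1, uIcc_of_le (hr.1.trans hrr')]
    exact Icc_subset_Icc_right hrr'
  -- Past the first failure the integral takes its junk value `0`.
  have hlate : ∀ r, sInf T < r → u r = x + g r := by
    intro r hr
    obtain ⟨r', hr', hlt⟩ := exists_lt_of_csInf_lt ⟨t, htT⟩ hr
    have := hup r' hr' r hlt.le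
    rw [hu r this.1, intervalIntegral.integral_undef this.2, sub_zero]
  have hearly : AEStronglyMeasurable (fun s => h (u s)) (volume.restrict (Ioo 0 (sInf T))) := by
    obtain ⟨v, -, hv1, hv2⟩ := exists_seq_strictMono_tendsto (sInf T)
    have hsub : Ioo 0 (sInf T) ⊆ ⋃ n, Ioc 0 (v n) := by
      intro s hs
      obtain ⟨n, hn⟩ := (hv2.eventually (lt_mem_nhds hs.2)).exists
      exact mem_iUnion.2 ⟨n, hs.1, hn.le⟩
    refine AEStronglyMeasurable.mono_set hsub ?_
    rw [aestronglyMeasurable_iUnion_iff]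
    intro n
    rcases le_or_gt 0 (v n) with h0 | h0
    · have : v n ∉ T := fun hmem => absurd (csInf_le hbdd hmem) (not_le.2 (hv1 n))
      have hi : IntervalIntegrable (fun s => h (u s)) volume 0 (v n) := by
        by_contra hni
        exact this ⟨h0, hni⟩
      exact hi.1.aestronglyMeasurable
    · rw [Ioc_eq_empty (by linarith)]
      simp
  have hlateM : AEStronglyMeasurable (fun s => h (u s)) (volume.restrict (Ioi (sInf T))) := by
    refine AEStronglyMeasurable.congr (f := fun s => h (x + g s))
      (hh.mono.measurable.comp (hg.const_add x)).aestronglyMeasurable ?_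
    filter_upwards [ae_restrict_mem measurableSet_Ioi] with s hs
    rw [hlate s hs]
  have hpt : AEStronglyMeasurable (fun s => h (u s)) (volume.restrict {sInf T}) := by
    rw [Measure.restrict_singleton]
    simp
  refine hcon (of_meas t ht ?_)
  refine AEStronglyMeasurable.mono_set (t := (Ioo 0 (sInf T) ∪ {sInf T}) ∪ Ioi (sInf T)) ?_ ?_
  · intro s hs
    rcases lt_trichotomy s (sInf T) with h1 | h1 | h1
    · exact Or.inl (Or.inl ⟨hs.1, h1⟩)
    · exact Or.inl (Or.inr h1)
    · exact Or.inr h1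
  · exact aestronglyMeasurable_union_iff.2 ⟨aestronglyMeasurable_union_iff.2 ⟨hearly, hpt⟩, hlateM⟩

end

/-! ### Moments from a smooth characteristic function -/

section

/-- The symmetric second difference of a smooth function is of quadratic order. -/
lemma exists_second_difference_bound {φ : ℝ → ℂ} (hφ : ContDiff ℝ (⊤ : ℕ∞) φ) :
    ∃ C δ : ℝ, 0 < δ ∧ ∀ u, |u| < δ → ‖φ u + φ (-u) - 2 * φ 0‖ ≤ C * u ^ 2 := by
  obtain ⟨hd, hφ'⟩ := contDiff_infty_iff_deriv.1 hφ
  have h1 : ContDiff ℝ 1 (deriv φ) := hφ'.of_le (by exact_mod_cast le_top)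
  obtain ⟨K, t, ht, hK⟩ := h1.contDiffAt.exists_lipschitzOnWith (x := 0)
  obtain ⟨δ, hδ, hball⟩ := Metric.mem_nhds_iff.1 ht
  refine ⟨K * 2, δ, hδ, fun u hu => ?_⟩
  have hG : ∀ v, HasDerivAt (fun v => φ v + φ (-v)) (deriv φ v - deriv φ (-v)) v := by
    intro v
    have h2 : HasDerivAt (fun v => φ (-v)) (-deriv φ (-v)) v := by
      have h3 := (hd (-v)).hasDerivAt.scomp v (hasDerivAt_neg v)
      rw [neg_one_smul] at h3
      exact h3
    rw [sub_eq_add_neg]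
    exact (hd v).hasDerivAt.add h2
  have hbound : ∀ v ∈ Metric.closedBall (0 : ℝ) |u|,
      ‖deriv φ v - deriv φ (-v)‖ ≤ K * 2 * |u| := by
    intro v hv
    rw [mem_closedBall_zero_iff, Real.norm_eq_abs] at hv
    have hm : ∀ w : ℝ, |w| = |v| → w ∈ t := fun w hw => hball (by
      rw [mem_ball_zero_iff, Real.norm_eq_abs, hw]
      exact hv.trans_lt hu)
    have := hK.norm_sub_le (hm v rfl) (hm (-v) (abs_neg v))
    refine this.trans ?_
    rw [sub_neg_eq_add, ← two_mul, norm_mul, Real.norm_eq_abs, Real.norm_eq_abs, abs_two,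
      ← mul_assoc]
    gcongr
  have := (convex_closedBall (0 : ℝ) |u|).norm_image_sub_le_of_norm_hasDerivWithin_le
    (fun v _ => (hG v).hasDerivWithinAt) hbound (x := 0) (y := u) (by simp) (by simp)
  simp only [neg_zero, sub_zero, Real.norm_eq_abs] at this
  rw [← two_mul, mul_assoc, abs_mul_abs_self, ← sq] at this
  exact this

lemma charFun_second_difference (μ : Measure ℝ) [IsFiniteMeasure μ] (u : ℝ) :
    Integrable (fun x => 2 * (1 - Real.cos (u * x))) μ ∧
    ∫ x, 2 * (1 - Real.cos (u * x)) ∂μ ≤ ‖charFun μ u + charFun μ (-u) - 2 * charFun μ 0‖ := by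
  have hi : ∀ v : ℝ, Integrable (fun x : ℝ => Complex.exp (v * x * Complex.I)) μ := by
    intro v
    refine (integrable_const (1 : ℝ)).mono' (by fun_prop) (Eventually.of_forall fun x => ?_)
    rw [← Complex.ofReal_mul, Complex.norm_exp_ofReal_mul_I]
  have hcos : ∀ x : ℝ, Complex.exp (u * x * Complex.I) + Complex.exp ((-u : ℝ) * x * Complex.I)
      - 2 * Complex.exp ((0 : ℝ) * x * Complex.I) = ((-(2 * (1 - Real.cos (u * x))) : ℝ) : ℂ) := by
    intro x
    have := Complex.two_cos (u * x)
    push_cast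
    rw [show -(2 * (1 - Complex.cos (u * x))) = 2 * Complex.cos (u * x) - 2 by ring, this]
    simp [neg_mul]
  have hint : Integrable (fun x => 2 * (1 - Real.cos (u * x))) μ := by
    refine (integrable_const (4 : ℝ)).mono' (by fun_prop) (Eventually.of_forall fun x => ?_)
    have h1 := Real.cos_le_one (u * x)
    have h2 := Real.neg_one_le_cos (u * x)
    rw [Real.norm_of_nonneg (by linarith)]
    linarith
  refine ⟨hint, ?_⟩
  simp only [charFun_apply_real]
  rw [← integral_const_mul, ← integral_add (hi u) (hi (-u)),
    ← integral_sub (f := fun x : ℝ => Complex.exp (u * x * Complex.I) +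
      Complex.exp ((-u : ℝ) * x * Complex.I)) ((hi u).add (hi (-u))) ((hi 0).const_mul 2)]
  simp only [hcos]
  rw [integral_complex_ofReal, Complex.norm_real, integral_neg, norm_neg]
  exact le_abs_self _

lemma integrable_sq_of_contDiff_charFun (μ : Measure ℝ) [IsFiniteMeasure μ]
    (hφ : ContDiff ℝ (⊤ : ℕ∞) (charFun μ)) : Integrable (fun x : ℝ => x ^ 2) μ := by
  obtain ⟨C, δ, hδ, hC⟩ := exists_second_difference_bound hφ
  have hlim : Tendsto (fun n : ℕ => (n : ℝ) + 1) atTop atTop :=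
    tendsto_atTop_add_const_right _ _ tendsto_natCast_atTop_atTop
  have hcov := aecover_Icc (μ := μ) (l := atTop) (a := fun n : ℕ => -((n : ℝ) + 1))
    (b := fun n : ℕ => ((n : ℝ) + 1)) (tendsto_neg_atTop_atBot.comp hlim) hlim
  refine hcov.integrable_of_integral_norm_bounded (Real.pi ^ 2 / 4 * C) (fun n => ?_) ?_
  · exact (continuous_pow 2).continuousOn.integrableOn_compact isCompact_Icc
  · have hev : ∀ᶠ n : ℕ in atTop, |1 / ((n : ℝ) + 1)| < δ := by
      have := (tendsto_one_div_add_atTop_nhds_zero_nat (𝕜 := ℝ)).abs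
      rw [abs_zero] at this
      exact this.eventually (gt_mem_nhds hδ)
    filter_upwards [hev] with n hn
    have hpos : (0 : ℝ) < n + 1 := by positivity
    set u : ℝ := 1 / ((n : ℝ) + 1) with hu
    have hu0 : 0 < u := by positivity
    obtain ⟨hint, hle⟩ := charFun_second_difference μ u
    have h1 := hle.trans (hC u hn)
    have hc : 0 < Real.pi ^ 2 / 4 / u ^ 2 := by positivity
    calc ∫ x in Icc (-((n : ℝ) + 1)) (n + 1), ‖x ^ 2‖ ∂μ
        ≤ ∫ x in Icc (-((n : ℝ) + 1)) (n + 1),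
            Real.pi ^ 2 / 4 / u ^ 2 * (2 * (1 - Real.cos (u * x))) ∂μ := by
          refine setIntegral_mono_on ?_ (hint.const_mul _).integrableOn measurableSet_Icc ?_
          · exact ((continuous_pow 2).norm).continuousOn.integrableOn_compact isCompact_Icc
          · intro x hx
            have hux : |u * x| ≤ Real.pi := by
              rw [abs_mul, abs_of_pos hu0]
              have : |x| ≤ n + 1 := abs_le.2 hx
              calc u * |x| ≤ u * (n + 1) := by gcongr
                _ = 1 := by rw [hu]; field_simp
                _ ≤ Real.pi := by linarith [Real.pi_gt_three]
            -- On the window `|x| ≤ n + 1 = 1 / u` the argument `u * x` stays within `[-π, π]`, where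
            -- `1 - cos` dominates a multiple of the square.
            have h3 := Real.cos_le_one_sub_mul_cos_sq hux
            rw [Real.norm_of_nonneg (by positivity), div_div, div_mul_eq_mul_div,
              le_div_iff₀ (by positivity)]
            have hp : 0 < Real.pi ^ 2 := by positivity
            have h4 : 2 * (u * x) ^ 2 ≤ Real.pi ^ 2 * (1 - Real.cos (u * x)) := by
              have : 2 / Real.pi ^ 2 * (u * x) ^ 2 ≤ 1 - Real.cos (u * x) := by linarith
              rw [div_mul_eq_mul_div, div_le_iff₀ hp] at this
              linarith
            nlinarith
      _ ≤ ∫ x, Real.pi ^ 2 / 4 / u ^ 2 * (2 * (1 - Real.cos (u * x))) ∂μ := by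
          refine setIntegral_le_integral (hint.const_mul _) (Eventually.of_forall fun x => ?_)
          have := Real.cos_le_one (u * x)
          exact mul_nonneg hc.le (by linarith)
      _ ≤ Real.pi ^ 2 / 4 / u ^ 2 * (C * u ^ 2) := by
          rw [integral_const_mul]
          gcongr
      _ = Real.pi ^ 2 / 4 * C := by field_simp

/-- A finite measure whose characteristic function is smooth has all its even moments: the second
derivative of the characteristic function is, up to sign, the characteristic function of the
measure with density `x ^ 2`, which allows induction. -/
lemma integrable_even_pow_of_contDiff_charFun (n : ℕ) : ∀ (μ : Measure ℝ) [IsFiniteMeasure μ],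
    ContDiff ℝ (⊤ : ℕ∞) (charFun μ) → Integrable (fun x : ℝ => x ^ (2 * n)) μ := by
  induction n with
  | zero =>
    intro μ _ _
    simp
  | succ n ih =>
    intro μ _ hφ
    have hsq := integrable_sq_of_contDiff_charFun μ hφ
    have hmeas : Measurable fun x : ℝ => ENNReal.ofReal (x ^ 2) := by fun_prop
    have hfin : IsFiniteMeasure (μ.withDensity fun x => ENNReal.ofReal (x ^ 2)) :=
      isFiniteMeasure_withDensity_ofReal hsq.2
    have hL2 : MemLp id ((2 : ℕ) : ℝ≥0∞) μ := by
      rw [Nat.cast_ofNat, memLp_two_iff_integrable_sq aestronglyMeasurable_id]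
      exact hsq
    have hchar : charFun (μ.withDensity fun x => ENNReal.ofReal (x ^ 2)) =
        fun u => -(iteratedDeriv 2 (charFun μ) u) := by
      funext u
      rw [iteratedDeriv_charFun hL2, charFun_apply_real,
        integral_withDensity_eq_integral_toReal_smul hmeas
          (Eventually.of_forall fun x => ENNReal.ofReal_lt_top)]
      rw [Complex.I_sq, neg_one_mul, neg_neg]
      refine integral_congr_ae (Eventually.of_forall fun x => ?_)
      simp only
      rw [ENNReal.toReal_ofReal (sq_nonneg x), Complex.real_smul]
      push_cast
      rfl
    have h2 := ih (μ.withDensity fun x => ENNReal.ofReal (x ^ 2)) (by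
      rw [hchar, iteratedDeriv_eq_iterate]
      exact (hφ.iterate_deriv 2).neg)
    rw [integrable_withDensity_iff_integrable_smul' hmeas
      (Eventually.of_forall fun x => ENNReal.ofReal_lt_top)] at h2
    refine h2.congr (Eventually.of_forall fun x => ?_)
    simp only [smul_eq_mul]
    rw [ENNReal.toReal_ofReal (sq_nonneg x)]
    ring

end

/-! ### Smoothness of the Lévy–Khintchine exponent -/

section

lemma norm_one_sub_exp_add_le (θ : ℝ) :
    ‖1 - Complex.exp (Complex.I * θ) + Complex.I * θ‖ ≤ 3 * θ ^ 2 := by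
  rcases le_or_gt |θ| 1 with h | h
  · have h1 : ‖Complex.I * (θ : ℂ)‖ = |θ| := by simp
    have := Complex.norm_exp_sub_one_sub_id_le (x := Complex.I * θ) (by rw [h1]; exact h)
    rw [h1, sq_abs] at this
    rw [← norm_neg, show -(1 - Complex.exp (Complex.I * θ) + Complex.I * θ) =
      Complex.exp (Complex.I * θ) - 1 - Complex.I * θ by ring]
    nlinarith [sq_nonneg θ]
  · have h1 : ‖Complex.exp (Complex.I * θ) - 1‖ ≤ |θ| := Real.norm_exp_I_mul_ofReal_sub_one_le
    have h2 : ‖Complex.I * (θ : ℂ)‖ = |θ| := by simp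
    have h3 := norm_sub_le (Complex.I * (θ : ℂ)) (Complex.exp (Complex.I * θ) - 1)
    rw [show 1 - Complex.exp (Complex.I * θ) + Complex.I * θ =
      Complex.I * θ - (Complex.exp (Complex.I * θ) - 1) by ring]
    have h4 : |θ| ≤ θ ^ 2 := by rw [← sq_abs]; nlinarith
    rw [h2] at h3
    nlinarith [sq_nonneg θ]

lemma IsLevyMeasure.integrableOn_sq {ν : Measure ℝ} (hν : IsLevyMeasure ν) :
    IntegrableOn (fun z : ℝ => z ^ 2) (Ioo (-1) 1) ν := by
  refine ⟨by fun_prop, ?_⟩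
  rw [hasFiniteIntegral_iff_ofReal (Eventually.of_forall fun z => sq_nonneg z)]
  refine lt_of_le_of_lt ?_ hν.lintegral_lt_top
  refine (setLIntegral_mono' measurableSet_Ioo fun z hz => ?_).trans (setLIntegral_le_lintegral _ _)
  have : z ^ 2 ≤ 1 := by
    have := hz.1; have := hz.2; nlinarith
  rw [min_eq_right this]

lemma IsLevyMeasure.measure_compl_lt_top {ν : Measure ℝ} (hν : IsLevyMeasure ν) :
    ν (Ioo (-1) 1)ᶜ < ∞ := by
  refine lt_of_le_of_lt ?_ hν.lintegral_lt_top
  rw [← setLIntegral_one]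
  refine (setLIntegral_mono' measurableSet_Ioo.compl fun z hz => ?_).trans
    (setLIntegral_le_lintegral _ _)
  have : 1 ≤ z ^ 2 := by
    rw [mem_compl_iff, mem_Ioo, not_and_or, not_lt, not_lt] at hz
    rcases hz with h | h <;> nlinarith
  rw [min_eq_left this, ENNReal.ofReal_one]

/-- The part of the exponent due to the small jumps is smooth: its second derivative is the
characteristic function of the finite measure `z ^ 2 ν(dz)` on `(-1, 1)`. -/
lemma contDiff_smallJumps {ν : Measure ℝ} (hν : IsLevyMeasure ν) :
    ContDiff ℝ (⊤ : ℕ∞) fun u : ℝ => ∫ z in Ioo (-1 : ℝ) 1,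
      (1 - Complex.exp (Complex.I * u * z) + Complex.I * u * z) ∂ν := by
  have hsq := hν.integrableOn_sq
  have hmeas : Measurable fun z : ℝ => ENNReal.ofReal (z ^ 2) := by fun_prop
  set m : Measure ℝ := (ν.restrict (Ioo (-1) 1)).withDensity fun z => ENNReal.ofReal (z ^ 2)
    with hm
  have hfin : IsFiniteMeasure m := isFiniteMeasure_withDensity_ofReal hsq.2
  have hmabs : ∀ᵐ z ∂m, |z| ≤ 1 := by
    refine (withDensity_absolutelyContinuous _ _).ae_le ?_
    filter_upwards [ae_restrict_mem measurableSet_Ioo] with z hz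
    exact abs_le.2 ⟨hz.1.le, hz.2.le⟩
  have hchar : ContDiff ℝ (⊤ : ℕ∞) (charFun m) := by
    refine contDiff_charFun' fun k => MemLp.of_bound aestronglyMeasurable_id 1 ?_
    simpa using hmabs
  have hcharm : ∀ u, charFun m u =
      ∫ z in Ioo (-1 : ℝ) 1, (z : ℂ) ^ 2 * Complex.exp (Complex.I * u * z) ∂ν := by
    intro u
    rw [charFun_apply_real, hm, integral_withDensity_eq_integral_toReal_smul hmeas
      (Eventually.of_forall fun x => ENNReal.ofReal_lt_top)]
    refine integral_congr_ae (Eventually.of_forall fun z => ?_)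
    simp only
    rw [ENNReal.toReal_ofReal (sq_nonneg z), Complex.real_smul]
    push_cast
    ring_nf
  have hθ : ∀ u z : ℝ, Complex.I * u * z = Complex.I * ((u * z : ℝ) : ℂ) := fun u z => by
    push_cast; ring
  have hexpnorm : ∀ u z : ℝ, ‖Complex.exp (Complex.I * u * z)‖ = 1 := fun u z => by
    rw [hθ, mul_comm, Complex.norm_exp_ofReal_mul_I]
  have hexpd : ∀ u z : ℝ, HasDerivAt (fun u : ℝ => Complex.exp (Complex.I * u * z))
      (Complex.exp (Complex.I * u * z) * (Complex.I * z)) u := by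
    intro u z
    have h1 : HasDerivAt (fun u : ℝ => Complex.I * (u : ℂ) * z) (Complex.I * z) u := by
      simpa using ((Complex.ofRealCLM.hasDerivAt (x := u)).const_mul Complex.I).mul_const (z : ℂ)
    exact h1.cexp
  have hint0 : ∀ u : ℝ, IntegrableOn (fun z : ℝ =>
      (1 - Complex.exp (Complex.I * u * z) + Complex.I * u * z)) (Ioo (-1) 1) ν := by
    intro u
    refine (hsq.const_mul (3 * u ^ 2)).mono' (by fun_prop) (Eventually.of_forall fun z => ?_)
    rw [hθ]
    refine (norm_one_sub_exp_add_le _).trans_eq ?_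
    ring
  have hb1 : ∀ u z : ℝ, ‖Complex.I * z * (1 - Complex.exp (Complex.I * u * z))‖ ≤ |u| * z ^ 2 := by
    intro u z
    rw [norm_mul, norm_mul, Complex.norm_I, one_mul, Complex.norm_real, Real.norm_eq_abs,
      norm_sub_rev, hθ]
    have : ‖Complex.exp (Complex.I * ((u * z : ℝ) : ℂ)) - 1‖ ≤ ‖u * z‖ :=
      Real.norm_exp_I_mul_ofReal_sub_one_le
    rw [Real.norm_eq_abs, abs_mul] at this
    calc |z| * _ ≤ |z| * (|u| * |z|) := by gcongr
      _ = |u| * z ^ 2 := by rw [← sq_abs z]; ring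
  have hd1 : ∀ u : ℝ, IntegrableOn (fun z : ℝ =>
      Complex.I * z * (1 - Complex.exp (Complex.I * u * z))) (Ioo (-1) 1) ν ∧
      HasDerivAt (fun u : ℝ => ∫ z in Ioo (-1 : ℝ) 1,
        (1 - Complex.exp (Complex.I * u * z) + Complex.I * u * z) ∂ν)
      (∫ z in Ioo (-1 : ℝ) 1, Complex.I * z * (1 - Complex.exp (Complex.I * u * z)) ∂ν) u := by
    intro u
    refine hasDerivAt_integral_of_dominated_loc_of_deriv_le
      (bound := fun z => (|u| + 1) * z ^ 2) (F' := fun (u : ℝ) (z : ℝ) =>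
        Complex.I * z * (1 - Complex.exp (Complex.I * u * z)))
      (Metric.ball_mem_nhds u one_pos) (Eventually.of_forall fun v => (hint0 v).1) (hint0 u)
      (by fun_prop) (Eventually.of_forall fun z v hv => ?_) (hsq.const_mul _)
      (Eventually.of_forall fun z v _ => ?_)
    · refine (hb1 v z).trans ?_
      have h1 : |v - u| < 1 := by simpa [Real.dist_eq] using hv
      have : |v| ≤ |u| + 1 := by
        have := abs_sub_abs_le_abs_sub v u
        linarith
      gcongr
    · have h1 : HasDerivAt (fun u : ℝ => Complex.I * (u : ℂ) * z) (Complex.I * z) v := by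
        simpa using ((Complex.ofRealCLM.hasDerivAt (x := v)).const_mul Complex.I).mul_const (z : ℂ)
      have h2 := ((hexpd v z).const_sub 1).add h1
      convert! h2 using 1
      ring
  have hd2 : ∀ u : ℝ, HasDerivAt (fun u : ℝ => ∫ z in Ioo (-1 : ℝ) 1,
      Complex.I * z * (1 - Complex.exp (Complex.I * u * z)) ∂ν) (charFun m u) u := by
    intro u
    rw [hcharm]
    refine (hasDerivAt_integral_of_dominated_loc_of_deriv_le
      (bound := fun z => z ^ 2) (F' := fun (u : ℝ) (z : ℝ) =>
        (z : ℂ) ^ 2 * Complex.exp (Complex.I * u * z))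
      (Metric.ball_mem_nhds u one_pos) (Eventually.of_forall fun v => (hd1 v).1.1) (hd1 u).1
      (by fun_prop) (Eventually.of_forall fun z v hv => ?_) hsq
      (Eventually.of_forall fun z v _ => ?_)).2
    · rw [norm_mul, hexpnorm, mul_one, norm_pow, Complex.norm_real, Real.norm_eq_abs, sq_abs]
    · have h2 := ((hexpd v z).const_sub 1).const_mul (Complex.I * (z : ℂ))
      convert! h2 using 1
      linear_combination ((z : ℂ) ^ 2 * Complex.exp (Complex.I * v * z)) * Complex.I_sq
  rw [contDiff_infty_iff_deriv]
  refine ⟨fun u => (hd1 u).2.differentiableAt, ?_⟩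
  rw [funext fun u => (hd1 u).2.deriv, contDiff_infty_iff_deriv]
  refine ⟨fun u => (hd2 u).differentiableAt, ?_⟩
  rw [funext fun u => (hd2 u).deriv]
  exact hchar

/-- Under an exponential moment of the large jumps, the Lévy–Khintchine exponent is smooth. -/
lemma contDiff_levyExponent {ν : Measure ℝ} (hν : IsLevyMeasure ν) (γ σ : ℝ)
    (hexp : ∃ θ : ℝ, 0 < θ ∧
      ∫⁻ z in (Ioo (-1 : ℝ) 1)ᶜ, ENNReal.ofReal (Real.exp (θ * |z|)) ∂ν < ∞) :
    ContDiff ℝ (⊤ : ℕ∞) (levyExponent γ σ ν) := by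
  obtain ⟨θ, hθ, hfinexp⟩ := hexp
  set big : Measure ℝ := ν.restrict (Ioo (-1 : ℝ) 1)ᶜ with hbig
  have hfin : IsFiniteMeasure big := ⟨by
    rw [hbig, Measure.restrict_apply_univ]
    exact hν.measure_compl_lt_top⟩
  have hexpint : Integrable (fun z : ℝ => Real.exp (θ * |z|)) big := by
    refine ⟨by fun_prop, ?_⟩
    rwa [hasFiniteIntegral_iff_ofReal (Eventually.of_forall fun z => (Real.exp_pos _).le)]
  have hmom : ∀ k : ℕ, MemLp id (k : ℝ≥0∞) big := by
    intro k
    rcases Nat.eq_zero_or_pos k with rfl | hk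
    · simpa using aestronglyMeasurable_id
    · rw [← integrable_norm_rpow_iff aestronglyMeasurable_id (by simpa using hk.ne') (by simp)]
      simp only [ENNReal.toReal_natCast, Real.rpow_natCast]
      refine (hexpint.const_mul (k.factorial / θ ^ k)).mono' (by fun_prop)
        (Eventually.of_forall fun z => ?_)
      rw [id, norm_pow, norm_norm, Real.norm_eq_abs]
      have := Real.pow_div_factorial_le_exp (θ * |z|) (by positivity) k
      rw [div_le_iff₀ (by positivity), mul_pow] at this
      rw [div_mul_eq_mul_div, le_div_iff₀ (by positivity)]
      linarith
  have hbigd : ContDiff ℝ (⊤ : ℕ∞) (charFun big) := contDiff_charFun' hmom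
  have hsmall := contDiff_smallJumps hν
  have hcase1 : ∀ u : ℝ, ∀ z ∈ Ioo (-1 : ℝ) 1, (1 - Complex.exp (Complex.I * u * z) +
      if |z| < 1 then Complex.I * u * z else 0) =
      1 - Complex.exp (Complex.I * u * z) + Complex.I * u * z := by
    intro u z hz
    rw [if_pos (abs_lt.2 hz)]
  have hcase2 : ∀ u : ℝ, ∀ z ∈ (Ioo (-1 : ℝ) 1)ᶜ, (1 - Complex.exp (Complex.I * u * z) +
      if |z| < 1 then Complex.I * u * z else 0) =
      1 - Complex.exp (u * z * Complex.I) := by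
    intro u z hz
    rw [if_neg (fun h => hz (abs_lt.1 h)), add_zero]
    ring_nf
  have hbigint : ∀ u : ℝ, Integrable (fun z : ℝ => Complex.exp (u * z * Complex.I)) big := by
    intro u
    refine (integrable_const (1 : ℝ)).mono' (by fun_prop) (Eventually.of_forall fun x => ?_)
    rw [← Complex.ofReal_mul, Complex.norm_exp_ofReal_mul_I]
  have hsmallint : ∀ u : ℝ, IntegrableOn (fun z : ℝ =>
      (1 - Complex.exp (Complex.I * u * z) + Complex.I * u * z)) (Ioo (-1) 1) ν := by
    intro u
    refine (hν.integrableOn_sq.const_mul (3 * u ^ 2)).mono' (by fun_prop)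
      (Eventually.of_forall fun z => ?_)
    rw [show Complex.I * u * z = Complex.I * ((u * z : ℝ) : ℂ) by push_cast; ring]
    refine (norm_one_sub_exp_add_le _).trans_eq ?_
    ring
  have hsplit : ∀ u : ℝ, ∫ z : ℝ, (1 - Complex.exp (Complex.I * u * z) +
      if |z| < 1 then Complex.I * u * z else 0) ∂ν =
      (∫ z in Ioo (-1 : ℝ) 1, (1 - Complex.exp (Complex.I * u * z) + Complex.I * u * z) ∂ν) +
      (big.real univ - charFun big u) := by
    intro u
    have hi1 : IntegrableOn (fun z : ℝ => (1 - Complex.exp (Complex.I * u * z) +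
        if |z| < 1 then Complex.I * u * z else 0)) (Ioo (-1) 1) ν :=
      (hsmallint u).congr_fun (fun z hz => (hcase1 u z hz).symm) measurableSet_Ioo
    have hi2 : IntegrableOn (fun z : ℝ => (1 - Complex.exp (Complex.I * u * z) +
        if |z| < 1 then Complex.I * u * z else 0)) (Ioo (-1) 1)ᶜ ν :=
      IntegrableOn.congr_fun (f := fun z : ℝ => 1 - Complex.exp (u * z * Complex.I))
        ((integrable_const (μ := big) (1 : ℂ)).sub (hbigint u))
        (fun z hz => (hcase2 u z hz).symm) measurableSet_Ioo.compl
    have hi : Integrable (fun z : ℝ => (1 - Complex.exp (Complex.I * u * z) +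
        if |z| < 1 then Complex.I * u * z else 0)) ν := by
      rw [← integrableOn_univ, ← union_compl_self (Ioo (-1 : ℝ) 1)]
      exact hi1.union hi2
    rw [← integral_add_compl measurableSet_Ioo hi, setIntegral_congr_fun measurableSet_Ioo
      (hcase1 u), setIntegral_congr_fun measurableSet_Ioo.compl (hcase2 u), ← hbig,
      integral_sub (integrable_const _) (hbigint u), integral_const, charFun_apply_real]
    simp
  unfold levyExponent
  simp only [hsplit]
  have hofReal : ContDiff ℝ (⊤ : ℕ∞) fun u : ℝ => (u : ℂ) := Complex.ofRealCLM.contDiff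
  exact ((contDiff_const.mul hofReal).neg.add (contDiff_const.mul (hofReal.pow 2))).add
    (hsmall.add (contDiff_const.sub hbigd))

end

/-! ### Discounting, and moments of the process at an exponential time -/

section

/-- The measure `e^{-qt} dt` on `(0, ∞)`. -/
noncomputable def discountMeasure (q : ℝ) : Measure ℝ :=
  (volume.restrict (Ioi 0)).withDensity fun t => ENNReal.ofReal (Real.exp (-q * t))

lemma integrableOn_exp_neg {q : ℝ} (hq : 0 < q) :
    IntegrableOn (fun t : ℝ => Real.exp (-q * t)) (Ioi 0) :=
  integrableOn_exp_mul_Ioi (by linarith) 0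

lemma isFiniteMeasure_discountMeasure {q : ℝ} (hq : 0 < q) :
    IsFiniteMeasure (discountMeasure q) :=
  isFiniteMeasure_withDensity_ofReal (integrableOn_exp_neg hq).2

instance (q : ℝ) : SFinite (discountMeasure q) := by
  unfold discountMeasure; infer_instance

lemma measurable_discount (q : ℝ) :
    Measurable fun t : ℝ => ENNReal.ofReal (Real.exp (-q * t)) := by fun_prop

lemma integral_discountMeasure {E : Type*} [NormedAddCommGroup E] [NormedSpace ℝ E] (q : ℝ)
    (g : ℝ → E) : ∫ t, g t ∂discountMeasure q = ∫ t in Ioi 0, Real.exp (-q * t) • g t := by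
  rw [discountMeasure, integral_withDensity_eq_integral_toReal_smul (measurable_discount q)
    (Eventually.of_forall fun _ => ENNReal.ofReal_lt_top)]
  simp only [ENNReal.toReal_ofReal (Real.exp_pos _).le]

lemma integral_exp_discountMeasure {q : ℝ} (hq : 0 < q) {c : ℂ} (hc : 0 ≤ c.re) :
    ∫ t : ℝ, Complex.exp (-(t * c)) ∂discountMeasure q = 1 / (q + c) := by
  rw [integral_discountMeasure]
  have h1 : (-(q + c)).re < 0 := by simp; linarith
  have h2 := integral_exp_mul_complex_Ioi h1 0
  have h3 : ∀ t : ℝ, Real.exp (-q * t) • Complex.exp (-(t * c)) = Complex.exp (-(q + c) * t) := by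
    intro t
    rw [Complex.real_smul, Complex.ofReal_exp, ← Complex.exp_add]
    congr 1
    push_cast
    ring
  simp only [h3, h2]
  rw [Complex.ofReal_zero, mul_zero, Complex.exp_zero, neg_div_neg_eq]

lemma discountMeasure_ae_pos (q : ℝ) : ∀ᵐ t ∂discountMeasure q, 0 < t :=
  (withDensity_absolutelyContinuous _ _).ae_le (ae_restrict_mem measurableSet_Ioi)

variable {Ω : Type*} [MeasurableSpace Ω]

/-- A property of almost all paths at all times holds almost everywhere in chance and time. -/
lemma ae_prod_discountMeasure {P : Measure Ω} [SFinite P] {q : ℝ} {R : Ω → ℝ → Prop}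
    (h : ∀ᵐ ω ∂P, ∀ t, 0 ≤ t → R ω t) :
    ∀ᵐ a ∂P.prod (discountMeasure q), R a.1 a.2 := by
  filter_upwards [Measure.quasiMeasurePreserving_fst.ae h,
    Measure.quasiMeasurePreserving_snd.ae (discountMeasure_ae_pos q)] with a h1 h2
  exact h1 a.2 h2.le

lemma prod_discountMeasure (P : Measure Ω) [SFinite P] (q : ℝ) :
    P.prod (discountMeasure q) = (P.prod (volume.restrict (Ioi (0 : ℝ)))).withDensity
      fun a => ENNReal.ofReal (Real.exp (-q * a.2)) :=
  prod_withDensity_right (measurable_discount q)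

lemma discountedIntegrable_iff {P : Measure Ω} [SFinite P] {q : ℝ} {Y : ℝ≥0 → Ω → ℝ} :
    DiscountedIntegrable P q Y ↔
      Integrable (fun a : Ω × ℝ => Y a.2.toNNReal a.1) (P.prod (discountMeasure q)) := by
  have hm : Measurable fun a : Ω × ℝ => ENNReal.ofReal (Real.exp (-q * a.2)) := by fun_prop
  rw [prod_discountMeasure, integrable_withDensity_iff_integrable_smul' hm
    (Eventually.of_forall fun _ => ENNReal.ofReal_lt_top)]
  simp only [ENNReal.toReal_ofReal (Real.exp_pos _).le]
  rfl

lemma discounted_eq {P : Measure Ω} [SFinite P] {q : ℝ} {Y : ℝ≥0 → Ω → ℝ}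
    (hY : Integrable (fun a : Ω × ℝ => Y a.2.toNNReal a.1) (P.prod (discountMeasure q))) :
    discounted P q Y = ∫ a : Ω × ℝ, Y a.2.toNNReal a.1 ∂P.prod (discountMeasure q) := by
  rw [integral_prod _ hY]
  unfold discounted
  simp only [integral_discountMeasure, smul_eq_mul]

/-- Almost surely the regularized path is the path itself. -/
lemma IsLevyProcess.ae_regularize_eq {X : ℝ≥0 → Ω → ℝ} {P : Measure Ω}
    (hX : IsLevyProcess X P) :
    ∀ᵐ ω ∂P, ∀ t : ℝ, 0 ≤ t → regularize (fun s => X s ω) t = X t.toNNReal ω := by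
  filter_upwards [hX.cadlag] with ω hω t ht
  exact regularize_eq ht (hω _).1

lemma IsLevyProcess.measurable_path {X : ℝ≥0 → Ω → ℝ} {P : Measure Ω}
    (hX : IsLevyProcess X P) : Measurable fun ω s => X s ω :=
  measurable_pi_lambda _ hX.measurable

lemma IsLevyProcess.measurable_regularize_path {X : ℝ≥0 → Ω → ℝ} {P : Measure Ω}
    (hX : IsLevyProcess X P) :
    Measurable fun a : Ω × ℝ => regularize (fun s => X s a.1) a.2 := by
  have h1 : Measurable fun a : Ω × ℝ => ((fun s => X s a.1 : ℝ≥0 → ℝ), a.2) :=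
    (hX.measurable_path.comp measurable_fst).prodMk measurable_snd
  have h2 := measurable_regularize.comp h1
  simp only [Function.comp_def] at h2
  exact h2

lemma abs_pow_le_one_add_even (x : ℝ) (N : ℕ) : |x| ^ N ≤ 1 + x ^ (2 * N) := by
  rw [pow_mul, ← sq_abs x, ← pow_mul, mul_comm, pow_mul]
  nlinarith [sq_nonneg (|x| ^ N - 1), pow_nonneg (abs_nonneg x) N]

lemma HasLevyTriplet.levyExponent_re_nonneg {X : ℝ≥0 → Ω → ℝ} {P : Measure Ω}
    [IsProbabilityMeasure P] {γ σ : ℝ} {ν : Measure ℝ}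
    (htriplet : HasLevyTriplet X P γ σ ν) (u : ℝ) : 0 ≤ (levyExponent γ σ ν u).re := by
  have h1 := htriplet.charFun_eq 1 u
  have h2 : ‖∫ ω, Complex.exp (Complex.I * u * X 1 ω) ∂P‖ ≤ 1 := by
    refine (norm_integral_le_of_norm_le_const (C := 1) (Eventually.of_forall fun ω => ?_)).trans
      (by simp)
    rw [show Complex.I * u * X 1 ω = ((u * X 1 ω : ℝ) : ℂ) * Complex.I by push_cast; ring,
      Complex.norm_exp_ofReal_mul_I]
  rw [h1, Complex.norm_exp] at h2
  simpa using h2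

/-- The process has moments of all orders at an independent exponential time. The law there has
characteristic function proportional to `1 / (q + Ψ)`, which is smooth. -/
lemma integrable_pow_levy {X : ℝ≥0 → Ω → ℝ} {P : Measure Ω} [IsProbabilityMeasure P]
    {γ σ : ℝ} {ν : Measure ℝ} {q : ℝ} (hX : IsLevyProcess X P)
    (htriplet : HasLevyTriplet X P γ σ ν)
    (hexp : ∃ θ : ℝ, 0 < θ ∧
      ∫⁻ z in (Ioo (-1 : ℝ) 1)ᶜ, ENNReal.ofReal (Real.exp (θ * |z|)) ∂ν < ∞)
    (hq : 0 < q) (N : ℕ) :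
    Integrable (fun a : Ω × ℝ => |X a.2.toNNReal a.1| ^ N) (P.prod (discountMeasure q)) := by
  have := isFiniteMeasure_discountMeasure hq
  set Y : Ω × ℝ → ℝ := fun a => regularize (fun s => X s a.1) a.2 with hY
  have hYm : Measurable Y := hX.measurable_regularize_path
  have hYX : ∀ᵐ a ∂P.prod (discountMeasure q), Y a = X a.2.toNNReal a.1 :=
    ae_prod_discountMeasure hX.ae_regularize_eq
  set μ : Measure ℝ := (P.prod (discountMeasure q)).map Y with hμ
  have hchar : charFun μ = fun u : ℝ => 1 / ((q : ℂ) + levyExponent γ σ ν u) := by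
    funext u
    have hint : Integrable (fun a : Ω × ℝ => Complex.exp (u * Y a * Complex.I))
        (P.prod (discountMeasure q)) := by
      refine (integrable_const (1 : ℝ)).mono' ?_ (Eventually.of_forall fun x => ?_)
      · exact Measurable.aestronglyMeasurable (by fun_prop)
      · rw [← Complex.ofReal_mul, Complex.norm_exp_ofReal_mul_I]
    rw [charFun_apply_real, hμ, integral_map hYm.aemeasurable (by fun_prop),
      integral_prod_symm _ hint, ← integral_exp_discountMeasure hq
        (htriplet.levyExponent_re_nonneg u)]
    refine integral_congr_ae ?_
    filter_upwards [discountMeasure_ae_pos q] with t ht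
    have h1 := htriplet.charFun_eq t.toNNReal u
    rw [Real.coe_toNNReal _ ht.le] at h1
    rw [← h1]
    refine integral_congr_ae ?_
    filter_upwards [hX.ae_regularize_eq] with ω hω
    simp only [hY, hω t ht.le]
    ring_nf
  have hsmooth : ContDiff ℝ (⊤ : ℕ∞) (charFun μ) := by
    rw [hchar]
    have h1 : ContDiff ℝ (⊤ : ℕ∞) fun u : ℝ => (q : ℂ) + levyExponent γ σ ν u :=
      contDiff_const.add (contDiff_levyExponent htriplet.levyMeasure γ σ hexp)
    simp only [one_div]
    refine h1.inv fun u h0 => ?_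
    have h1 := congrArg Complex.re h0
    have h2 := htriplet.levyExponent_re_nonneg u
    simp at h1
    linarith
  have h2 := integrable_even_pow_of_contDiff_charFun N μ hsmooth
  rw [hμ, integrable_map_measure (by fun_prop) hYm.aemeasurable] at h2
  refine ((integrable_const (1 : ℝ)).add h2).mono' ?_ ?_
  · refine AEStronglyMeasurable.congr (f := fun a => |Y a| ^ N)
      (Measurable.aestronglyMeasurable (by fun_prop)) ?_
    filter_upwards [hYX] with a ha
    rw [ha]
  · filter_upwards [hYX] with a ha
    simp only [Pi.add_apply, Function.comp]
    rw [ha, Real.norm_of_nonneg (by positivity)]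
    exact abs_pow_le_one_add_even _ N

lemma integrable_pow_discountMeasure {q : ℝ} (hq : 0 < q) (N : ℕ) :
    Integrable (fun t : ℝ => |t| ^ N) (discountMeasure q) := by
  have := isFiniteMeasure_discountMeasure hq
  have hchar : charFun (discountMeasure q) = fun u : ℝ => 1 / ((q : ℂ) + -(u * Complex.I)) := by
    funext u
    rw [charFun_apply_real, ← integral_exp_discountMeasure hq (by simp)]
    congr 1
    funext t
    ring_nf
  have hsmooth : ContDiff ℝ (⊤ : ℕ∞) (charFun (discountMeasure q)) := by
    rw [hchar]
    have hofReal : ContDiff ℝ (⊤ : ℕ∞) fun u : ℝ => (u : ℂ) := Complex.ofRealCLM.contDiff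
    have h1 : ContDiff ℝ (⊤ : ℕ∞) fun u : ℝ => (q : ℂ) + -(u * Complex.I) :=
      contDiff_const.add (hofReal.mul contDiff_const).neg
    simp only [one_div]
    refine h1.inv fun u h0 => ?_
    have h1 := congrArg Complex.re h0
    simp at h1
    linarith
  refine ((integrable_const (1 : ℝ)).add
    (integrable_even_pow_of_contDiff_charFun N _ hsmooth)).mono' (by fun_prop) ?_
  refine Eventually.of_forall fun t => ?_
  simp only [Pi.add_apply]
  rw [Real.norm_of_nonneg (by positivity)]
  exact abs_pow_le_one_add_even _ N

/-- A function of chance and time that grows at most polynomially in the process and in time is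
integrable. -/
lemma integrable_of_poly_growth {X : ℝ≥0 → Ω → ℝ} {P : Measure Ω} [IsProbabilityMeasure P]
    {q : ℝ} (hq : 0 < q)
    (hmom : ∀ N : ℕ, Integrable (fun a : Ω × ℝ => |X a.2.toNNReal a.1| ^ N)
      (P.prod (discountMeasure q)))
    {G : Ω × ℝ → ℝ} (hG : AEStronglyMeasurable G (P.prod (discountMeasure q)))
    {k₁ k₂ c α : ℝ} {N : ℕ} (hk₂ : 0 ≤ k₂) (hc : 0 ≤ c) (hα : 0 ≤ α)
    (hb : ∀ᵐ a ∂P.prod (discountMeasure q),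
      |G a| ≤ k₁ + k₂ * (c + |X a.2.toNNReal a.1| + α * |a.2|) ^ N) :
    Integrable G (P.prod (discountMeasure q)) := by
  have := isFiniteMeasure_discountMeasure hq
  have ht : Integrable (fun a : Ω × ℝ => |a.2| ^ N) (P.prod (discountMeasure q)) :=
    (integrable_pow_discountMeasure hq N).comp_snd P
  refine (((integrable_const k₁).add (((integrable_const (c ^ N)).add ((hmom N).add
    (ht.const_mul (α ^ N)))).const_mul (k₂ * 3 ^ N)))).mono' hG ?_
  filter_upwards [hb] with a ha
  refine ha.trans ?_
  simp only [Pi.add_apply]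
  have h3 : (c + |X a.2.toNNReal a.1| + α * |a.2|) ^ N ≤
      3 ^ N * (c ^ N + (|X a.2.toNNReal a.1| ^ N + α ^ N * |a.2| ^ N)) := by
    rw [← mul_pow α]
    set x := |X a.2.toNNReal a.1|
    have hx : 0 ≤ x := abs_nonneg _
    have hy : 0 ≤ α * |a.2| := by positivity
    generalize α * |a.2| = y at hy
    have hm : c + x + y ≤ 3 * max c (max x y) := by
      have := le_max_left c (max x y)
      have := (le_max_left x y).trans (le_max_right c (max x y))
      have := (le_max_right x y).trans (le_max_right c (max x y))
      linarith
    refine (pow_le_pow_left₀ (by positivity) hm N).trans ?_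
    rw [mul_pow]
    refine mul_le_mul_of_nonneg_left ?_ (by positivity)
    have h1 := pow_nonneg hc N
    have h2 := pow_nonneg hx N
    have h3 := pow_nonneg hy N
    rcases max_choice c (max x y) with h | h
    · rw [h]; linarith
    · rw [h]
      rcases max_choice x y with h | h <;> rw [h] <;> linarith
  calc _ ≤ k₁ + k₂ * (3 ^ N * (c ^ N + (|X a.2.toNNReal a.1| ^ N + α ^ N * |a.2| ^ N))) := by gcongr
    _ = _ := by ring

end

/-! ### Pathwise properties of refracted processes -/

section

variable {Ω : Type*} [MeasurableSpace Ω]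

lemma isRate_refractionRate (X : ℝ≥0 → Ω → ℝ) (P : Measure Ω) (γ : ℝ) (ν : Measure ℝ) {α : ℝ}
    (hα : 0 ≤ α) (b : ℝ) : IsRate (refractionRate X P γ ν α b) α := by
  have hdrift : IsCaseTwo X P γ ν α → 0 ≤ levyDrift γ ν ∧ levyDrift γ ν ≤ α := fun h => h.2
  have hnn : ∀ y, 0 ≤ refractionRate X P γ ν α b y := by
    intro y
    unfold refractionRate
    split_ifs with h1 h2
    · exact hα
    · exact (hdrift h2.2).1
    · exact le_rfl
  have hle : ∀ y, refractionRate X P γ ν α b y ≤ α := by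
    intro y
    unfold refractionRate
    split_ifs with h1 h2
    · exact le_rfl
    · exact (hdrift h2.2).2
    · exact hα
  refine ⟨fun y z hyz => ?_, hnn, hle⟩
  rcases hyz.eq_or_lt with rfl | hlt
  · exact le_rfl
  by_cases hz : b < z
  · refine (hle y).trans_eq ?_
    simp [refractionRate, hz]
  · have h1 : ¬ b < y := by linarith
    have h2 : y ≠ b := by intro h; exact hz (h ▸ hlt)
    have : refractionRate X P γ ν α b y = 0 := by simp [refractionRate, h1, h2]
    rw [this]
    exact hnn z

lemma refractionRate_of_lt {X : ℝ≥0 → Ω → ℝ} {P : Measure Ω} {γ : ℝ} {ν : Measure ℝ} {α b y : ℝ}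
    (h : b < y) : refractionRate X P γ ν α b y = α := by simp [refractionRate, h]

lemma refractionRate_of_gt {X : ℝ≥0 → Ω → ℝ} {P : Measure Ω} {γ : ℝ} {ν : Measure ℝ} {α b y : ℝ}
    (h : y < b) : refractionRate X P γ ν α b y = 0 := by
  simp [refractionRate, not_lt.2 h.le, h.ne]

lemma refractionRate_add (X : ℝ≥0 → Ω → ℝ) (P : Measure Ω) (γ : ℝ) (ν : Measure ℝ)
    (α b y : ℝ) : refractionRate X P γ ν α b (y + b) = refractionRate X P γ ν α 0 y := by
  classical
  unfold refractionRate
  refine if_congr (by simp) rfl (if_congr ?_ rfl rfl)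
  rw [add_eq_right]

/-- Restarting a solution at time `s`, with the driving path re-centred by `c`. -/
lemma SolvesODE.shift {h g y g' : ℝ → ℝ} (hy : SolvesODE h g y) {s c : ℝ} (hs : 0 ≤ s)
    (hg' : ∀ u, 0 ≤ u → g' u = g (s + u) - c) : SolvesODE h g' fun u => y (s + u) + c := by
  have heq : ∀ u, 0 ≤ u → h (g' u + (y (s + u) + c)) = h (g (s + u) + y (s + u)) := by
    intro u hu
    rw [hg' u hu]
    ring_nf
  constructor
  · intro a b ha hb
    have h1 := (hy.integrable (s + a) (s + b) (by linarith) (by linarith)).comp_add_left s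
    rw [add_sub_cancel_left, add_sub_cancel_left] at h1
    refine h1.congr (fun u hu => ?_)
    have : 0 < u := (le_min ha hb).trans_lt hu.1
    exact (heq u this.le).symm
  · intro a b ha hab
    have h1 : ∫ u in a..b, h (g' u + (y (s + u) + c)) = ∫ u in a..b, h (g (s + u) + y (s + u)) := by
      refine intervalIntegral.integral_congr fun u hu => ?_
      rw [uIcc_of_le hab] at hu
      exact heq u (ha.trans hu.1)
    rw [h1, hy.eq (s + a) (s + b) (by linarith) (by linarith),
      ← intervalIntegral.integral_comp_add_left (fun t => h (g t + y t)) s]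
    ring

lemma measurable_regularize_apply (p : ℝ≥0 → ℝ) : Measurable (regularize p) := by
  have h1 : Measurable fun t : ℝ => (p, t) := measurable_prodMk_left
  have h2 := measurable_regularize.comp h1
  simp only [Function.comp_def] at h2
  exact h2

/-- On almost every path, a strong solution minus the driving process solves the integral equation
along the regularized path. -/
lemma IsStrongSolution.ae_solvesODE {X : ℝ≥0 → Ω → ℝ} {P : Measure Ω} (hX : IsLevyProcess X P)
    {h : ℝ → ℝ} {α : ℝ} (hh : IsRate h α) {x : ℝ} {U : ℝ≥0 → Ω → ℝ}
    (hU : IsStrongSolution h X P x U) :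
    ∀ᵐ ω ∂P, SolvesODE h (regularize fun r => X r ω)
      (fun t => U t.toNNReal ω - X t.toNNReal ω) ∧ U 0 ω - X 0 ω = x := by
  filter_upwards [hX.ae_regularize_eq, hU.equation] with ω hreg heq
  have hU' : ∀ t : ℝ, 0 ≤ t → U t.toNNReal ω = x + regularize (fun r => X r ω) t -
      ∫ s in (0 : ℝ)..t, h (U s.toNNReal ω) := by
    intro t ht
    rw [hreg t ht, heq t.toNNReal, Real.coe_toNNReal _ ht]
  have hint : ∀ t : ℝ, 0 ≤ t → IntervalIntegrable (fun s : ℝ => h (U s.toNNReal ω)) volume 0 t :=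
    fun t ht => intervalIntegrable_of_integral_equation hh (u := fun s => U s.toNNReal ω)
      (measurable_regularize_apply _) x hU' ht
  have hcongr : ∀ s : ℝ, 0 ≤ s → h (regularize (fun r => X r ω) s +
      (U s.toNNReal ω - X s.toNNReal ω)) = h (U s.toNNReal ω) := by
    intro s hs
    rw [hreg s hs, add_sub_cancel]
  refine ⟨⟨fun a b ha hb => ?_, fun a b ha hab => ?_⟩, ?_⟩
  · refine ((hint a ha).symm.trans (hint b hb)).congr (fun s hs => ?_)
    have : 0 < s := (le_min ha hb).trans_lt hs.1
    exact (hcongr s this.le).symm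
  · have hb := ha.trans hab
    rw [intervalIntegral.integral_congr (g := fun s : ℝ => h (U s.toNNReal ω)),
      ← intervalIntegral.integral_interval_sub_left (hint b hb) (hint a ha), hU' a ha, hU' b hb,
      hreg a ha, hreg b hb]
    · ring
    · intro s hs
      rw [uIcc_of_le hab] at hs
      exact hcongr s (ha.trans hs.1)
  · have h0 := hU' 0 le_rfl
    rw [hreg 0 le_rfl, intervalIntegral.integral_same, Real.toNNReal_zero] at h0
    rw [h0]
    ring

/-- The refracted process as a jointly measurable function of chance and time. -/
noncomputable def stateFlow (X : ℝ≥0 → Ω → ℝ) (h : ℝ → ℝ) (x : ℝ) (a : Ω × ℝ) : ℝ :=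
  flow h x (regularize fun r => X r a.1) a.2

lemma measurable_stateFlow {X : ℝ≥0 → Ω → ℝ} {P : Measure Ω} (hX : IsLevyProcess X P)
    {h : ℝ → ℝ} {α : ℝ} (hh : IsRate h α) (x : ℝ) : Measurable (stateFlow X h x) := by
  have h1 : Measurable fun a : Ω × ℝ => ((fun s => X s a.1 : ℝ≥0 → ℝ), a.2) :=
    (hX.measurable_path.comp measurable_fst).prodMk measurable_snd
  have h2 := (measurable_flow hh x).comp h1
  simp only [Function.comp_def] at h2
  exact h2

section
variable {X : ℝ≥0 → Ω → ℝ} {P : Measure Ω} {h : ℝ → ℝ} {α : ℝ} {U : ℝ → ℝ≥0 → Ω → ℝ}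

lemma ae_eq_stateFlow (hX : IsLevyProcess X P) (hh : IsRate h α) {x : ℝ}
    (hU : IsStrongSolution h X P x (U x)) :
    ∀ᵐ ω ∂P, ∀ t : ℝ, 0 ≤ t → U x t.toNNReal ω = stateFlow X h x (ω, t) := by
  filter_upwards [hX.ae_regularize_eq, hU.ae_solvesODE hX hh] with ω hreg hs t ht
  have h1 := hs.1.eq_flow hh (measurable_regularize_apply _) ht
  simp only [Real.toNNReal_zero, hs.2] at h1
  rw [hreg t ht, add_sub_cancel] at h1
  exact h1

lemma ae_stateFlow_mono (hX : IsLevyProcess X P) (hh : IsRate h α)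
    (hU : ∀ x, IsStrongSolution h X P x (U x)) {x y : ℝ} (hxy : x ≤ y) :
    ∀ᵐ ω ∂P, ∀ t : ℝ, 0 ≤ t → stateFlow X h x (ω, t) ≤ stateFlow X h y (ω, t) := by
  filter_upwards [hX.ae_regularize_eq, (hU x).ae_solvesODE hX hh,
    ae_eq_stateFlow hX hh (hU x)] with ω hreg hs heq t ht
  have h1 := hs.1.le_flow hh (measurable_regularize_apply _) (x := y)
    (by simp only [Real.toNNReal_zero, hs.2]; exact hxy) ht
  rw [hreg t ht, add_sub_cancel, heq t ht] at h1
  exact h1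

lemma ae_stateFlow_eq_integral (hX : IsLevyProcess X P) (hh : IsRate h α)
    (hU : ∀ x, IsStrongSolution h X P x (U x)) (x : ℝ) :
    ∀ᵐ ω ∂P, ∀ t : ℝ, 0 ≤ t →
      IntervalIntegrable (fun s => h (stateFlow X h x (ω, s))) volume 0 t ∧
      stateFlow X h x (ω, t) = x + X t.toNNReal ω -
        ∫ s in (0 : ℝ)..t, h (stateFlow X h x (ω, s)) := by
  filter_upwards [(hU x).equation, ae_eq_stateFlow hX hh (hU x)] with ω heqn heq t ht
  refine ⟨hh.intervalIntegrable ((measurable_stateFlow hX hh x).comp measurable_prodMk_left) 0 t, ?_⟩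
  rw [← heq t ht, heqn, Real.coe_toNNReal _ ht]
  congr 1
  refine intervalIntegral.integral_congr fun s hs => ?_
  rw [uIcc_of_le ht] at hs
  simp only [heq s hs.1]

lemma ae_stateFlow_bound (hX : IsLevyProcess X P) (hh : IsRate h α)
    (hU : ∀ x, IsStrongSolution h X P x (U x)) (x : ℝ) :
    ∀ᵐ ω ∂P, ∀ t : ℝ, 0 ≤ t →
      |stateFlow X h x (ω, t)| ≤ |x| + |X t.toNNReal ω| + α * |t| := by
  filter_upwards [ae_stateFlow_eq_integral hX hh hU x] with ω heq t ht
  have h1 := integral_rate_mem hh (g := fun s => stateFlow X h x (ω, s))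
    ((measurable_stateFlow hX hh x).comp measurable_prodMk_left) ht
  rw [(heq t ht).2, abs_of_nonneg ht]
  rw [sub_zero] at h1
  refine (abs_sub _ _).trans ?_
  rw [abs_of_nonneg h1.1]
  linarith [abs_add_le x (X t.toNNReal ω), h1.2]

/-- Comparison, after time `s`, with the process started at `b` and driven by the shifted
process. -/
lemma ae_stateFlow_shift (hX : IsLevyProcess X P) (hh : IsRate h α)
    (hU : ∀ x, IsStrongSolution h X P x (U x)) (x b : ℝ) {s : ℝ} (hs : 0 ≤ s) :
    ∀ᵐ ω ∂P, ∀ u : ℝ, 0 ≤ u →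
      (stateFlow X h x (ω, s) ≤ b →
        stateFlow X h x (ω, s + u) ≤ stateFlow (shifted X s.toNNReal) h b (ω, u)) ∧
      (b ≤ stateFlow X h x (ω, s) →
        stateFlow (shifted X s.toNNReal) h b (ω, u) ≤ stateFlow X h x (ω, s + u)) := by
  filter_upwards [hX.cadlag, hX.ae_regularize_eq, (hU x).ae_solvesODE hX hh,
    ae_eq_stateFlow hX hh (hU x)] with ω hcad hreg hsol heq u hu
  have hadd : ∀ r : ℝ, 0 ≤ r → s.toNNReal + r.toNNReal = (s + r).toNNReal := fun r hr =>
    (Real.toNNReal_add hs hr).symm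
  have hshift : ∀ r : ℝ, 0 ≤ r → regularize (fun r => shifted X s.toNNReal r ω) r =
      regularize (fun r => X r ω) (s + r) - X s.toNNReal ω := by
    intro r hr
    rw [hreg (s + r) (by linarith), ← hadd r hr]
    refine regularize_eq (p := fun r => shifted X s.toNNReal r ω) hr ?_
    have hc : ContinuousWithinAt (fun r : ℝ≥0 => X (s.toNNReal + r) ω) (Ici r.toNNReal)
        r.toNNReal := by
      refine ContinuousWithinAt.comp (t := Ici (s.toNNReal + r.toNNReal))
        (g := fun r => X r ω) (hcad _).1 (by fun_prop) fun r' hr' => ?_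
      exact add_le_add_right (mem_Ici.1 hr') _
    exact hc.sub continuousWithinAt_const
  have hsol' := hsol.1.shift hs hshift
  have h0 : (U x (s + 0).toNNReal ω - X (s + 0).toNNReal ω + X s.toNNReal ω) =
      stateFlow X h x (ω, s) := by
    rw [add_zero, sub_add_cancel, heq s hs]
  have h1 : regularize (fun r => shifted X s.toNNReal r ω) u +
      (U x (s + u).toNNReal ω - X (s + u).toNNReal ω + X s.toNNReal ω) =
      stateFlow X h x (ω, s + u) := by
    rw [hshift u hu, hreg (s + u) (by linarith), ← heq (s + u) (by linarith)]
    ring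
  constructor
  · intro hle
    have := hsol'.le_flow hh (measurable_regularize_apply _) (x := b) (by rw [h0]; exact hle) hu
    rw [h1] at this
    exact this
  · intro hle
    have := hsol'.flow_le hh (measurable_regularize_apply _) (x := b) (by rw [h0]; exact hle) hu
    rw [h1] at this
    exact this

lemma aestronglyMeasurable_stateFlow (hX : IsLevyProcess X P) (hh : IsRate h α)
    (hU : ∀ x, IsStrongSolution h X P x (U x)) (x : ℝ) {s : ℝ} (hs : 0 ≤ s) :
    AEStronglyMeasurable[naturalSigma X s.toNNReal] (fun ω => stateFlow X h x (ω, s)) P := by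
  refine ((hU x).adapted s.toNNReal).congr ?_
  filter_upwards [ae_eq_stateFlow hX hh (hU x)] with ω hω
  exact hω s hs

end

/-- Spatial homogeneity: the process refracted at `b` and started there is a translate of the
process refracted at `0` and started at `0`. -/
lemma ae_stateFlow_translate {X : ℝ≥0 → Ω → ℝ} {P : Measure Ω} {γ : ℝ} {ν : Measure ℝ} {α : ℝ}
    {U : ℝ → ℝ → ℝ≥0 → Ω → ℝ} (hX : IsLevyProcess X P) (hα : 0 ≤ α)
    (hU : ∀ b x : ℝ, IsStrongSolution (refractionRate X P γ ν α b) X P x (U b x)) (b : ℝ) :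
    ∀ᵐ ω ∂P, ∀ t : ℝ, 0 ≤ t → U b b t.toNNReal ω = U 0 0 t.toNNReal ω + b := by
  have hb := isRate_refractionRate X P γ ν hα b
  have h0 := isRate_refractionRate X P γ ν hα 0
  filter_upwards [hX.ae_regularize_eq, (hU b b).ae_solvesODE hX hb, (hU 0 0).ae_solvesODE hX h0]
    with ω hreg h1 h2 t ht
  have h3 : SolvesODE (refractionRate X P γ ν α 0) (regularize fun r => X r ω)
      (fun t => U b b t.toNNReal ω - X t.toNNReal ω - b) := by
    have hc : ∀ s : ℝ, refractionRate X P γ ν α 0 (regularize (fun r => X r ω) s +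
        (U b b s.toNNReal ω - X s.toNNReal ω - b)) = refractionRate X P γ ν α b
        (regularize (fun r => X r ω) s + (U b b s.toNNReal ω - X s.toNNReal ω)) := by
      intro s
      rw [← refractionRate_add X P γ ν α b]
      congr 1
      ring
    constructor
    · intro u v hu hv
      simp only [hc]
      exact h1.1.integrable u v hu hv
    · intro u v hu huv
      simp only [hc]
      rw [h1.1.eq u v hu huv]
      ring
  have h4 := h3.eq_flow h0 (measurable_regularize_apply _) ht
  have h5 := h2.1.eq_flow h0 (measurable_regularize_apply _) ht
  simp only [Real.toNNReal_zero, h1.2, h2.2, sub_self] at h4 h5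
  linarith

end

/-! ### Time shift, independence of the future, and order of integration -/

section

/-- The lack of memory of exponential discounting. -/
lemma map_add_discountMeasure (q : ℝ) {s : ℝ} (hs : 0 ≤ s) :
    (discountMeasure q).map (fun u => s + u) =
      ENNReal.ofReal (Real.exp (q * s)) • (discountMeasure q).restrict (Ioi s) := by
  ext A hA
  have hpre : MeasurableSet ((fun u => s + u) ⁻¹' A) := measurable_const_add s hA
  rw [Measure.map_apply (measurable_const_add s) hA, Measure.smul_apply,
    Measure.restrict_apply hA, discountMeasure, withDensity_apply _ hpre,
    withDensity_apply _ (hA.inter measurableSet_Ioi), Measure.restrict_restrict hpre,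
    Measure.restrict_restrict (hA.inter measurableSet_Ioi), smul_eq_mul,
    ← lintegral_const_mul _ (measurable_discount q),
    ← lintegral_indicator (hpre.inter measurableSet_Ioi),
    ← lintegral_indicator ((hA.inter measurableSet_Ioi).inter measurableSet_Ioi),
    ← lintegral_add_left_eq_self ((A ∩ Ioi s ∩ Ioi 0).indicator fun t =>
      ENNReal.ofReal (Real.exp (q * s)) * ENNReal.ofReal (Real.exp (-q * t))) s]
  congr 1
  funext u
  have h1 : s + u ∈ A ∩ Ioi s ∩ Ioi 0 ↔ u ∈ (fun u => s + u) ⁻¹' A ∩ Ioi 0 := by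
    simp only [mem_inter_iff, mem_Ioi, mem_preimage]
    constructor
    · rintro ⟨⟨h1, h2⟩, -⟩
      exact ⟨h1, by linarith⟩
    · rintro ⟨h1, h2⟩
      exact ⟨⟨h1, by linarith⟩, by linarith⟩
  by_cases h : u ∈ (fun u => s + u) ⁻¹' A ∩ Ioi 0
  · rw [indicator_of_mem h, indicator_of_mem (h1.2 h),
      ← ENNReal.ofReal_mul (Real.exp_pos _).le, ← Real.exp_add]
    ring_nf
  · rw [indicator_of_notMem h, indicator_of_notMem (fun h' => h (h1.1 h'))]

variable {Ω : Type*} [MeasurableSpace Ω]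

/-- Shifting time, as a measurable equivalence of `Ω × ℝ`. -/
def timeShift (Ω : Type*) [MeasurableSpace Ω] (s : ℝ) : Ω × ℝ ≃ᵐ Ω × ℝ :=
  (MeasurableEquiv.refl Ω).prodCongr (MeasurableEquiv.addLeft s)

lemma map_timeShift (P : Measure Ω) [SFinite P] (q : ℝ) {s : ℝ} (hs : 0 ≤ s) :
    (P.prod (discountMeasure q)).map (timeShift Ω s) =
      ENNReal.ofReal (Real.exp (q * s)) • (P.prod (discountMeasure q)).restrict (univ ×ˢ Ioi s) := by
  have h1 : (timeShift Ω s : Ω × ℝ → Ω × ℝ) = Prod.map id (fun u => s + u) := rfl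
  rw [h1, ← Measure.map_prod_map _ _ measurable_id (measurable_const_add s), Measure.map_id,
    map_add_discountMeasure q hs, Measure.prod_smul_right, ← Measure.prod_restrict,
    Measure.restrict_univ]

lemma integrable_timeShift {P : Measure Ω} [SFinite P] {q : ℝ} {s : ℝ} (hs : 0 ≤ s)
    {G : Ω × ℝ → ℝ} (hG : Integrable G (P.prod (discountMeasure q))) :
    Integrable (fun a : Ω × ℝ => G (a.1, s + a.2)) (P.prod (discountMeasure q)) := by
  have h1 : Integrable G ((P.prod (discountMeasure q)).map (timeShift Ω s)) := by
    rw [map_timeShift P q hs]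
    exact hG.restrict.smul_measure ENNReal.ofReal_ne_top
  exact (timeShift Ω s).measurableEmbedding.integrable_map_iff.1 h1

lemma setIntegral_timeShift (P : Measure Ω) [SFinite P] (q : ℝ) {s : ℝ} (hs : 0 ≤ s)
    (G : Ω × ℝ → ℝ) :
    ∫ a in univ ×ˢ Ioi s, G a ∂P.prod (discountMeasure q) =
      Real.exp (-q * s) * ∫ a, G (a.1, s + a.2) ∂P.prod (discountMeasure q) := by
  have h1 := (timeShift Ω s).measurableEmbedding.integral_map
    (μ := P.prod (discountMeasure q)) G
  rw [map_timeShift P q hs, integral_smul_measure,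
    ENNReal.toReal_ofReal (Real.exp_pos _).le] at h1
  have h2 : ∫ a, G (timeShift Ω s a) ∂P.prod (discountMeasure q) =
      ∫ a, G (a.1, s + a.2) ∂P.prod (discountMeasure q) := rfl
  rw [← h2, ← h1, smul_eq_mul, ← mul_assoc, ← Real.exp_add]
  simp

/-- A bounded variable known at time `s` is independent of functionals of the shifted process, whose
expectations are those of the same functionals of the process itself. -/
lemma integral_mul_shifted {X : ℝ≥0 → Ω → ℝ} {P : Measure Ω} [IsProbabilityMeasure P]
    (hX : IsLevyProcess X P) {q : ℝ} (s : ℝ≥0) {m : Ω → ℝ} {α : ℝ}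
    (hm : AEStronglyMeasurable[naturalSigma X s] m P) (hmα : ∀ ω, |m ω| ≤ α)
    {F : (ℝ≥0 → ℝ) × ℝ → ℝ} (hF : Measurable F)
    (hFX : Integrable (fun a : Ω × ℝ => F (fun r => X r a.1, a.2)) (P.prod (discountMeasure q))) :
    Integrable (fun a : Ω × ℝ => m a.1 * F (fun r => shifted X s r a.1, a.2))
      (P.prod (discountMeasure q)) ∧
    ∫ a, m a.1 * F (fun r => shifted X s r a.1, a.2) ∂P.prod (discountMeasure q) =
      (∫ ω, m ω ∂P) * ∫ a, F (fun r => X r a.1, a.2) ∂P.prod (discountMeasure q) := by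
  have hpath : Measurable fun (ω : Ω) (r : ℝ≥0) => X r ω := hX.measurable_path
  have hpath' : Measurable fun (ω : Ω) (r : ℝ≥0) => shifted X s r ω :=
    measurable_pi_lambda _ fun u => hX.measurable_shifted s u
  have hnat : naturalSigma X s ≤ ‹MeasurableSpace Ω› :=
    iSup₂_le fun r _ => (hX.measurable r).comap_le
  have hnat' : naturalSigma X s ≤ MeasurableSpace.comap (fun ω (r : Iic s) => X r ω) inferInstance := by
    refine iSup₂_le fun r hr => ?_
    have h1 : X r = (fun v : Iic s → ℝ => v ⟨r, hr⟩) ∘ (fun ω (r : Iic s) => X r ω) := rfl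
    rw [h1, ← MeasurableSpace.comap_comp]
    exact MeasurableSpace.comap_mono (measurable_pi_apply _).comap_le
  have hmP : AEStronglyMeasurable m P := hm.mono hnat
  -- Integrability passes to the shifted process because the two laws on paths agree.
  have hlaw : P.map (fun ω r => shifted X s r ω) = P.map (fun ω r => X r ω) :=
    (hX.identDistrib_shifted s).map_eq
  have hprod : (P.prod (discountMeasure q)).map
      (Prod.map (fun (ω : Ω) (r : ℝ≥0) => shifted X s r ω) (id : ℝ → ℝ)) =
      (P.prod (discountMeasure q)).map (Prod.map (fun (ω : Ω) (r : ℝ≥0) => X r ω) (id : ℝ → ℝ)) := by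
    rw [← Measure.map_prod_map _ _ hpath' measurable_id, hlaw,
      Measure.map_prod_map _ _ hpath measurable_id]
  have hFm : ∀ μ : Measure ((ℝ≥0 → ℝ) × ℝ), AEStronglyMeasurable F μ :=
    fun μ => hF.aestronglyMeasurable
  have hFS : Integrable (fun a : Ω × ℝ => F (fun r => shifted X s r a.1, a.2))
      (P.prod (discountMeasure q)) := by
    have h1 := (integrable_map_measure (hFm _) (hpath.prodMap measurable_id).aemeasurable).2 hFX
    rw [← hprod] at h1
    exact (integrable_map_measure (hFm _) (hpath'.prodMap measurable_id).aemeasurable).1 h1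
  have hFeq : ∫ a, F (fun r => shifted X s r a.1, a.2) ∂P.prod (discountMeasure q) =
      ∫ a, F (fun r => X r a.1, a.2) ∂P.prod (discountMeasure q) := by
    have h1 := integral_map (hpath.prodMap measurable_id).aemeasurable
      (hFm ((P.prod (discountMeasure q)).map (Prod.map (fun (ω : Ω) (r : ℝ≥0) => X r ω) id)))
    have h2 := integral_map (hpath'.prodMap measurable_id).aemeasurable
      (hFm ((P.prod (discountMeasure q)).map (Prod.map (fun (ω : Ω) (r : ℝ≥0) => shifted X s r ω) id)))
    rw [hprod] at h2
    exact h2.symm.trans h1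
  have hint : Integrable (fun a : Ω × ℝ => m a.1 * F (fun r => shifted X s r a.1, a.2))
      (P.prod (discountMeasure q)) :=
    hFS.bdd_mul (c := α) hmP.comp_fst (Eventually.of_forall fun a => hmα a.1)
  refine ⟨hint, ?_⟩
  set K : (ℝ≥0 → ℝ) → ℝ := fun p => ∫ u, F (p, u) ∂discountMeasure q with hK
  have hKm : Measurable K := (hF.stronglyMeasurable.integral_prod_right').measurable
  have hind : IndepFun m (fun ω => K fun r => shifted X s r ω) P := by
    have h1 := (IndepFun_iff_Indep _ _ _).1 (hX.indepFun_shifted s)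
    have h2 := indep_of_indep_of_le_left h1 hnat'
    have h3 : IndepFun (hm.mk m) (fun ω r => shifted X s r ω) P := by
      rw [IndepFun_iff_Indep]
      exact indep_of_indep_of_le_left h2 hm.stronglyMeasurable_mk.measurable.comap_le
    exact (h3.comp measurable_id hKm).congr hm.ae_eq_mk.symm (ae_eq_refl _)
  have h1 : ∫ a, m a.1 * F (fun r => shifted X s r a.1, a.2) ∂P.prod (discountMeasure q) =
      ∫ ω, m ω * K (fun r => shifted X s r ω) ∂P := by
    rw [integral_prod _ hint]
    simp only [hK, integral_const_mul]
  rw [h1, hind.integral_fun_mul_eq_mul_integral hmP (hKm.comp hpath').aestronglyMeasurable,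
    ← hFeq, integral_prod _ hFS]

/-- If, for every `s`, the part of `G` after time `s` weighted by `m` at time `s` is at most `c`
times the discounted weight, then so it is for `G` weighted by the integral of `m`. -/
lemma integral_mul_primitive_le {P : Measure Ω} [IsProbabilityMeasure P] {q : ℝ} (hq : 0 < q)
    {G m : Ω × ℝ → ℝ} (hGm : Measurable G) (hG : Integrable G (P.prod (discountMeasure q)))
    (hm : Measurable m) {α ε c : ℝ} (hm0 : ∀ a, 0 ≤ m a) (hmα : ∀ a, m a ≤ α)
    (hε : ∀ᵐ ω ∂P, ∀ t : ℝ, 0 ≤ t → ∫ s in (0 : ℝ)..t, m (ω, s) ≤ ε)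
    (hc : ∀ s : ℝ, 0 < s → ∫ a in univ ×ˢ Ioi s, m (a.1, s) * G a ∂P.prod (discountMeasure q) ≤
      Real.exp (-q * s) * ((∫ ω, m (ω, s) ∂P) * c)) :
    Integrable (fun a => G a * ∫ s in (0 : ℝ)..a.2, m (a.1, s)) (P.prod (discountMeasure q)) ∧
    ∫ a, G a * (∫ s in (0 : ℝ)..a.2, m (a.1, s)) ∂P.prod (discountMeasure q) ≤
      (∫ a, m a ∂P.prod (discountMeasure q)) * c := by
  have := isFiniteMeasure_discountMeasure hq
  set M := P.prod (discountMeasure q) with hM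
  set L : Measure ℝ := volume.restrict (Ioi 0) with hL
  set T : Ω × ℝ → ℝ → ℝ := fun a s => (Iio a.2).indicator (fun s => m (a.1, s) * G a) s with hT
  have hTm : Measurable (Function.uncurry T) := by
    have h1 : Function.uncurry T = {b : (Ω × ℝ) × ℝ | b.2 < b.1.2}.indicator
        (fun b => m (b.1.1, b.2) * G b.1) := by
      funext b
      rfl
    rw [h1]
    refine Measurable.indicator ?_ (measurableSet_lt measurable_snd (by fun_prop))
    exact (hm.comp (by fun_prop)).mul (hGm.comp measurable_fst)
  have hmint : ∀ ω : Ω, ∀ a b : ℝ, IntervalIntegrable (fun s => m (ω, s)) volume a b := by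
    intro ω a b
    refine (intervalIntegrable_const (c := α)).mono_fun
      (hm.comp measurable_prodMk_left).aestronglyMeasurable (Eventually.of_forall fun s => ?_)
    show ‖m (ω, s)‖ ≤ ‖α‖
    rw [Real.norm_of_nonneg (hm0 _), Real.norm_of_nonneg ((hm0 (ω, s)).trans (hmα _))]
    exact hmα _
  have hTint : ∀ a : Ω × ℝ, 0 ≤ a.2 → Integrable (T a) L ∧
      ∫ s, T a s ∂L = G a * ∫ s in (0 : ℝ)..a.2, m (a.1, s) := by
    intro a ha
    have h0 : Iio a.2 ∩ Ioi 0 = Ioo 0 a.2 := by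
      ext s; simp [and_comm]
    constructor
    · rw [hT, integrable_indicator_iff measurableSet_Iio, hL, IntegrableOn,
        Measure.restrict_restrict measurableSet_Iio, h0]
      have := (intervalIntegrable_iff_integrableOn_Ioc_of_le ha).1 (hmint a.1 0 a.2)
      exact (this.mono_set Ioo_subset_Ioc_self).mul_const (G a)
    · rw [hT, integral_indicator measurableSet_Iio, hL,
        Measure.restrict_restrict measurableSet_Iio, h0, intervalIntegral.integral_of_le ha,
        ← integral_Ioc_eq_integral_Ioo, integral_mul_const, mul_comm]
  have hTabs : ∀ a s, ‖T a s‖ = (Iio a.2).indicator (fun s => m (a.1, s) * |G a|) s := by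
    intro a s
    show ‖(Iio a.2).indicator (fun s => m (a.1, s) * G a) s‖ = _
    by_cases h : s ∈ Iio a.2
    · rw [indicator_of_mem h, indicator_of_mem h, norm_mul, Real.norm_of_nonneg (hm0 _),
        Real.norm_eq_abs]
    · rw [indicator_of_notMem h, indicator_of_notMem h, norm_zero]
  have hpos : ∀ᵐ a ∂M, 0 ≤ a.2 ∧ ∫ s in (0 : ℝ)..a.2, m (a.1, s) ≤ ε := by
    refine ae_prod_discountMeasure (R := fun ω t => 0 ≤ t ∧ ∫ s in (0 : ℝ)..t, m (ω, s) ≤ ε) ?_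
    filter_upwards [hε] with ω hω t ht
    exact ⟨ht, hω t ht⟩
  have hnormint : ∀ a : Ω × ℝ, 0 ≤ a.2 →
      ∫ s, ‖T a s‖ ∂L = |G a| * ∫ s in (0 : ℝ)..a.2, m (a.1, s) := by
    intro a ha
    have h0 : Iio a.2 ∩ Ioi 0 = Ioo 0 a.2 := by
      ext s; simp [and_comm]
    simp only [hTabs]
    rw [integral_indicator measurableSet_Iio, hL,
        Measure.restrict_restrict measurableSet_Iio, h0, intervalIntegral.integral_of_le ha,
        ← integral_Ioc_eq_integral_Ioo, integral_mul_const, mul_comm]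
  have hTprod : Integrable (Function.uncurry T) (M.prod L) := by
    rw [integrable_prod_iff hTm.aestronglyMeasurable]
    refine ⟨?_, ?_⟩
    · filter_upwards [hpos] with a ha
      exact (hTint a ha.1).1
    · refine (hG.norm.mul_const ε).mono'
        (hTm.stronglyMeasurable.norm.integral_prod_right').aestronglyMeasurable ?_
      filter_upwards [hpos] with a ha
      have h1 : ∫ s, ‖Function.uncurry T (a, s)‖ ∂L = _ := hnormint a ha.1
      rw [h1, Real.norm_of_nonneg]
      · exact mul_le_mul_of_nonneg_left ha.2 (abs_nonneg _)
      · exact mul_nonneg (abs_nonneg _)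
          (intervalIntegral.integral_nonneg ha.1 fun s _ => hm0 _)
  have hae : (fun a => ∫ s, T a s ∂L) =ᵐ[M] fun a => G a * ∫ s in (0 : ℝ)..a.2, m (a.1, s) := by
    filter_upwards [hpos] with a ha
    exact (hTint a ha.1).2
  refine ⟨(hTprod.integral_prod_left).congr hae, ?_⟩
  rw [← integral_congr_ae hae, integral_integral_swap hTprod]
  have hmM : Integrable m M := (integrable_const α).mono' hm.aestronglyMeasurable
    (Eventually.of_forall fun a => by rw [Real.norm_of_nonneg (hm0 a)]; exact hmα a)
  have hms : Integrable (fun s => ∫ ω, m (ω, s) ∂P) (discountMeasure q) := hmM.integral_prod_right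
  have hRHS : (∫ a, m a ∂M) * c = ∫ s, Real.exp (-q * s) * ((∫ ω, m (ω, s) ∂P) * c) ∂L := by
    rw [integral_prod_symm _ hmM, integral_discountMeasure, ← integral_mul_const]
    simp only [smul_eq_mul, mul_assoc]
    rfl
  rw [hRHS]
  refine integral_mono_ae hTprod.integral_prod_right ?_ ?_
  · have h1 : Integrable (fun s => (∫ ω, m (ω, s) ∂P) * c) (discountMeasure q) := hms.mul_const c
    rw [discountMeasure, integrable_withDensity_iff_integrable_smul' (measurable_discount q)
      (Eventually.of_forall fun _ => ENNReal.ofReal_lt_top)] at h1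
    simp only [ENNReal.toReal_ofReal (Real.exp_pos _).le, smul_eq_mul] at h1
    exact h1
  · filter_upwards [ae_restrict_mem measurableSet_Ioi] with s hs
    refine le_of_eq_of_le ?_ (hc s hs)
    rw [← integral_indicator (MeasurableSet.univ.prod measurableSet_Ioi)]
    congr 1
    funext a
    by_cases h : s < a.2
    · rw [indicator_of_mem (show a ∈ univ ×ˢ Ioi s from ⟨mem_univ _, h⟩)]
      exact indicator_of_mem (s := Iio a.2) h _
    · rw [indicator_of_notMem (fun h' : a ∈ univ ×ˢ Ioi s => h h'.2)]
      exact indicator_of_notMem (s := Iio a.2) h _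

end

/-! ### Convex cost functions -/

section

section Convex
variable {f : ℝ → ℝ}

lemma tangent_le (hf : ContDiff ℝ 1 f) (hc : ConvexOn ℝ univ f) (x y : ℝ) :
    deriv f x * (y - x) ≤ f y - f x := by
  have hd : ∀ x, DifferentiableAt ℝ f x := hf.differentiable one_ne_zero
  rcases lt_trichotomy x y with h | rfl | h
  · have := hc.deriv_le_slope (mem_univ x) (mem_univ y) h (hd x)
    rw [slope_def_field, le_div_iff₀ (by linarith)] at this
    exact this
  · simp
  · have := hc.slope_le_deriv (mem_univ y) (mem_univ x) h (hd x)
    rw [slope_def_field, div_le_iff₀ (by linarith)] at this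
    linarith

lemma monotone_deriv (hf : ContDiff ℝ 1 f) (hc : ConvexOn ℝ univ f) : Monotone (deriv f) :=
  fun _ _ h => hc.monotoneOn_deriv (fun x _ => hf.differentiable one_ne_zero x)
    (mem_univ _) (mem_univ _) h

lemma abs_deriv_le (hf : ContDiff ℝ 1 f) (hc : ConvexOn ℝ univ f) {k₁ k₂ : ℝ} {N : ℕ}
    (hk₂ : 0 ≤ k₂) (hb : ∀ x, |f x| ≤ k₁ + k₂ * |x| ^ N) (x : ℝ) :
    |deriv f x| ≤ 2 * k₁ + 2 * k₂ * (1 + |x|) ^ N := by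
  have h1 := tangent_le hf hc x (x + 1)
  have h2 := tangent_le hf hc x (x - 1)
  have hb' : ∀ y, |y| ≤ 1 + |x| → |f y| ≤ k₁ + k₂ * (1 + |x|) ^ N := fun y hy =>
    (hb y).trans (by gcongr)
  have h3 := abs_le.1 (hb' x (by linarith))
  have h4 := abs_le.1 (hb' (x + 1) (by linarith [abs_add_le x 1, abs_one (α := ℝ)]))
  have h5 := abs_le.1 (hb' (x - 1) (by linarith [abs_sub x 1, abs_one (α := ℝ)]))
  rw [abs_le]
  constructor <;> linarith

/-- A function whose increments are squeezed by a continuous `W` is convex and continuously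
differentiable with derivative `W`. -/
lemma convex_contDiff_of_increment_bounds {v W : ℝ → ℝ} (hW : Continuous W)
    (h : ∀ x y, x < y → (y - x) * W x ≤ v y - v x ∧ v y - v x ≤ (y - x) * W y) :
    ConvexOn ℝ univ v ∧ ContDiff ℝ 1 v ∧ ∀ x, HasDerivAt v (W x) x := by
  have hmono : Monotone W := by
    intro x y hxy
    rcases hxy.eq_or_lt with rfl | hlt
    · exact le_rfl
    · obtain ⟨h1, h2⟩ := h x y hlt
      exact le_of_mul_le_mul_left (h1.trans h2) (by linarith)
  have hderiv : ∀ x, HasDerivAt v (W x) x := by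
    intro x
    rw [hasDerivAt_iff_tendsto_slope]
    have hlim : Tendsto W (𝓝[≠] x) (𝓝 (W x)) := hW.continuousAt.tendsto.mono_left nhdsWithin_le_nhds
    have hlo : Tendsto (fun y => min (W x) (W y)) (𝓝[≠] x) (𝓝 (W x)) := by
      simpa using (tendsto_const_nhds (x := W x)).min hlim
    have hhi : Tendsto (fun y => max (W x) (W y)) (𝓝[≠] x) (𝓝 (W x)) := by
      simpa using (tendsto_const_nhds (x := W x)).max hlim
    have hmem : ∀ y, y ≠ x → min (W x) (W y) ≤ slope v x y ∧ slope v x y ≤ max (W x) (W y) := by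
      intro y hy
      rcases lt_or_gt_of_ne hy with hlt | hlt
      · obtain ⟨h1, h2⟩ := h y x hlt
        rw [slope_comm, slope_def_field]
        constructor
        · rw [le_div_iff₀ (by linarith)]
          exact (mul_le_mul_of_nonneg_right (min_le_right _ _) (by linarith)).trans (by linarith)
        · rw [div_le_iff₀ (by linarith)]
          exact le_trans (by linarith) (mul_le_mul_of_nonneg_right (le_max_left _ _) (by linarith))
      · obtain ⟨h1, h2⟩ := h x y hlt
        rw [slope_def_field]
        constructor
        · rw [le_div_iff₀ (by linarith)]
          exact (mul_le_mul_of_nonneg_right (min_le_left _ _) (by linarith)).trans (by linarith)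
        · rw [div_le_iff₀ (by linarith)]
          exact le_trans (by linarith) (mul_le_mul_of_nonneg_right (le_max_right _ _) (by linarith))
    refine tendsto_of_tendsto_of_tendsto_of_le_of_le' hlo hhi ?_ ?_
    · filter_upwards [self_mem_nhdsWithin] with y hy using (hmem y hy).1
    · filter_upwards [self_mem_nhdsWithin] with y hy using (hmem y hy).2
  have hd : Differentiable ℝ v := fun x => (hderiv x).differentiableAt
  have hde : deriv v = W := funext fun x => (hderiv x).deriv
  refine ⟨Monotone.convexOn_univ_of_deriv hd (by rwa [hde]), ?_, hderiv⟩
  rw [contDiff_one_iff_deriv, hde]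
  exact ⟨hd, hW⟩

end Convex

/-! ### Integrability and continuity of expected discounted costs -/

variable {Ω : Type*} [MeasurableSpace Ω]

/-- The process has discounted moments of all orders, and `f` is a convex, continuously
differentiable cost of at most polynomial growth. -/
structure CostSetting (X : ℝ≥0 → Ω → ℝ) (P : Measure Ω) (q : ℝ) (f : ℝ → ℝ) : Prop where
  q_pos : 0 < q
  moments : ∀ N : ℕ, Integrable (fun a : Ω × ℝ => |X a.2.toNNReal a.1| ^ N)
    (P.prod (discountMeasure q))
  smooth : ContDiff ℝ 1 f
  convex : ConvexOn ℝ univ f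
  growth : ∃ k₁ k₂ : ℝ, ∃ N : ℕ, 0 ≤ k₂ ∧ ∀ x, |f x| ≤ k₁ + k₂ * |x| ^ N

namespace CostSetting
variable {X : ℝ≥0 → Ω → ℝ} {P : Measure Ω} [IsProbabilityMeasure P] {q : ℝ} {f : ℝ → ℝ}

lemma integrable_cost (hS : CostSetting X P q f) {Z : Ω × ℝ → ℝ}
    (hZ : AEStronglyMeasurable Z (P.prod (discountMeasure q))) {c α : ℝ} (hc : 0 ≤ c) (hα : 0 ≤ α)
    (hb : ∀ᵐ a ∂P.prod (discountMeasure q), |Z a| ≤ c + |X a.2.toNNReal a.1| + α * |a.2|) :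
    Integrable (fun a => f (Z a)) (P.prod (discountMeasure q)) := by
  obtain ⟨k₁, k₂, N, hk₂, hg⟩ := hS.growth
  refine integrable_of_poly_growth (k₁ := k₁) (N := N) hS.q_pos hS.moments
    (hS.smooth.continuous.comp_aestronglyMeasurable hZ) hk₂ hc hα ?_
  filter_upwards [hb] with a ha
  exact (hg _).trans (by gcongr)

/-- An integrable bound for `f'` along processes that are close to `X`. -/
lemma exists_deriv_bound (hS : CostSetting X P q f) {c α : ℝ} (hc : 0 ≤ c) (hα : 0 ≤ α) :
    ∃ B : Ω × ℝ → ℝ, Integrable B (P.prod (discountMeasure q)) ∧ ∀ (z : ℝ) (a : Ω × ℝ),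
      |z| ≤ c + |X a.2.toNNReal a.1| + α * |a.2| → |deriv f z| ≤ B a := by
  obtain ⟨k₁, k₂, N, hk₂, hg⟩ := hS.growth
  refine ⟨fun a => 2 * k₁ + 2 * k₂ * ((1 + c) + |X a.2.toNNReal a.1| + α * |a.2|) ^ N, ?_, ?_⟩
  · have hXm : AEStronglyMeasurable (fun a : Ω × ℝ => |X a.2.toNNReal a.1|)
        (P.prod (discountMeasure q)) := by
      simpa using (hS.moments 1).aestronglyMeasurable
    have h2 : AEStronglyMeasurable (fun a : Ω × ℝ => α * |a.2|) (P.prod (discountMeasure q)) :=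
      Measurable.aestronglyMeasurable (by fun_prop)
    refine integrable_of_poly_growth (k₁ := |2 * k₁|) (k₂ := 2 * k₂) (c := 1 + c) (α := α) (N := N)
      hS.q_pos hS.moments ?_
      (by positivity) (by positivity) hα (Eventually.of_forall fun a => ?_)
    · exact ((((hXm.const_add (1 + c)).add h2).pow N).const_mul (2 * k₂)).const_add (2 * k₁)
    · exact (abs_add_le _ _).trans (add_le_add le_rfl (abs_of_nonneg (by positivity)).le)
  · intro z a hz
    refine (abs_deriv_le hS.smooth hS.convex hk₂ hg z).trans ?_
    have : 1 + |z| ≤ (1 + c) + |X a.2.toNNReal a.1| + α * |a.2| := by linarith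
    dsimp only
    gcongr

lemma integrable_deriv (hS : CostSetting X P q f) {Z : Ω × ℝ → ℝ}
    (hZ : AEStronglyMeasurable Z (P.prod (discountMeasure q))) {c α : ℝ} (hc : 0 ≤ c) (hα : 0 ≤ α)
    (hb : ∀ᵐ a ∂P.prod (discountMeasure q), |Z a| ≤ c + |X a.2.toNNReal a.1| + α * |a.2|) :
    Integrable (fun a => deriv f (Z a)) (P.prod (discountMeasure q)) := by
  obtain ⟨B, hB, hle⟩ := hS.exists_deriv_bound hc hα
  refine hB.mono' ((hS.smooth.continuous_deriv le_rfl).comp_aestronglyMeasurable hZ) ?_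
  filter_upwards [hb] with a ha using hle _ _ ha

/-- The expected discounted marginal cost is continuous in the starting point. -/
lemma continuous_integral_deriv (hS : CostSetting X P q f) {Z : ℝ → Ω × ℝ → ℝ}
    (hZ : ∀ x, AEStronglyMeasurable (Z x) (P.prod (discountMeasure q))) {α : ℝ} (hα : 0 ≤ α)
    (hb : ∀ x, ∀ᵐ a ∂P.prod (discountMeasure q), |Z x a| ≤ |x| + |X a.2.toNNReal a.1| + α * |a.2|)
    (hlip : ∀ x y, ∀ᵐ a ∂P.prod (discountMeasure q), |Z y a - Z x a| ≤ |y - x|) :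
    Continuous fun x => ∫ a, deriv f (Z x a) ∂P.prod (discountMeasure q) := by
  have hcd := hS.smooth.continuous_deriv le_rfl
  rw [continuous_iff_seqContinuous]
  intro u x hu
  obtain ⟨C, hC⟩ := hu.norm.bddAbove_range
  have hC' : ∀ n, |u n| ≤ C := fun n => hC ⟨n, rfl⟩
  obtain ⟨B, hB, hle⟩ := hS.exists_deriv_bound ((abs_nonneg _).trans (hC' 0)) hα
  refine tendsto_integral_of_dominated_convergence B
    (fun n => hcd.comp_aestronglyMeasurable (hZ _)) hB (fun n => ?_) ?_
  · filter_upwards [hb (u n)] with a ha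
    refine hle _ _ (ha.trans ?_)
    gcongr
    exact hC' n
  · have h1 : ∀ᵐ a ∂P.prod (discountMeasure q), ∀ n, |Z (u n) a - Z x a| ≤ |u n - x| :=
      ae_all_iff.2 fun n => hlip x (u n)
    filter_upwards [h1] with a ha
    refine hcd.continuousAt.tendsto.comp ?_
    rw [tendsto_iff_dist_tendsto_zero]
    refine squeeze_zero (fun n => dist_nonneg) (fun n => ?_) (tendsto_iff_dist_tendsto_zero.1 hu)
    rw [Real.dist_eq, Real.dist_eq]
    exact ha n

end CostSetting

end

/-! ### The increments of the cost function of a refraction strategy -/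

section

variable {Ω : Type*}

/-- The difference of the control rates of the refracted processes started at `y` and at `x`.
Truncation at `0` only matters on a null set if `x ≤ y`. -/
noncomputable def rateGap (X : ℝ≥0 → Ω → ℝ) (h : ℝ → ℝ) (x y : ℝ) (a : Ω × ℝ) : ℝ :=
  max (h (stateFlow X h y a) - h (stateFlow X h x a)) 0

lemma rateGap_nonneg {X : ℝ≥0 → Ω → ℝ} {h : ℝ → ℝ} (x y : ℝ) (a : Ω × ℝ) :
    0 ≤ rateGap X h x y a := le_max_right _ _

lemma rateGap_le {X : ℝ≥0 → Ω → ℝ} {h : ℝ → ℝ} {α : ℝ} (hh : IsRate h α) (x y : ℝ)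
    (a : Ω × ℝ) : rateGap X h x y a ≤ α :=
  max_le (by linarith [hh.nonneg (stateFlow X h x a), hh.le (stateFlow X h y a)]) hh.bound_nonneg

variable [MeasurableSpace Ω]

section
variable {X : ℝ≥0 → Ω → ℝ} {P : Measure Ω} {h : ℝ → ℝ} {α : ℝ} {U : ℝ → ℝ≥0 → Ω → ℝ}

lemma measurable_rateGap (hX : IsLevyProcess X P) (hh : IsRate h α) (x y : ℝ) :
    Measurable (rateGap X h x y) :=
  ((hh.mono.measurable.comp (measurable_stateFlow hX hh y)).sub
    (hh.mono.measurable.comp (measurable_stateFlow hX hh x))).max measurable_const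

lemma aestronglyMeasurable_rateGap (hX : IsLevyProcess X P) (hh : IsRate h α)
    (hU : ∀ x, IsStrongSolution h X P x (U x)) (x y : ℝ) {s : ℝ} (hs : 0 ≤ s) :
    AEStronglyMeasurable[naturalSigma X s.toNNReal] (fun ω => rateGap X h x y (ω, s)) P := by
  have hx := aestronglyMeasurable_stateFlow hX hh hU x hs
  have hy := aestronglyMeasurable_stateFlow hX hh hU y hs
  refine ⟨fun ω => max (h (hy.mk _ ω) - h (hx.mk _ ω)) 0, ?_, ?_⟩
  · exact (((hh.mono.measurable.comp hy.stronglyMeasurable_mk.measurable).sub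
      (hh.mono.measurable.comp hx.stronglyMeasurable_mk.measurable)).max
        measurable_const).stronglyMeasurable
  · filter_upwards [hx.ae_eq_mk, hy.ae_eq_mk] with ω h1 h2
    simp only [rateGap, h1, h2]

/-- Almost surely the gap between the two processes starts at `y - x` and decreases at the rate
`rateGap`. -/
lemma ae_gap_eq (hX : IsLevyProcess X P) (hh : IsRate h α)
    (hU : ∀ x, IsStrongSolution h X P x (U x)) {x y : ℝ} (hxy : x ≤ y) :
    ∀ᵐ ω ∂P, ∀ t : ℝ, 0 ≤ t →
      stateFlow X h x (ω, t) ≤ stateFlow X h y (ω, t) ∧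
      rateGap X h x y (ω, t) = h (stateFlow X h y (ω, t)) - h (stateFlow X h x (ω, t)) ∧
      stateFlow X h y (ω, t) - stateFlow X h x (ω, t) =
        (y - x) - ∫ s in (0 : ℝ)..t, rateGap X h x y (ω, s) := by
  filter_upwards [ae_stateFlow_mono hX hh hU hxy, ae_stateFlow_eq_integral hX hh hU x,
    ae_stateFlow_eq_integral hX hh hU y] with ω hmono hx hy t ht
  have hgap : ∀ s : ℝ, 0 ≤ s → rateGap X h x y (ω, s) =
      h (stateFlow X h y (ω, s)) - h (stateFlow X h x (ω, s)) := fun s hs =>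
    max_eq_left (sub_nonneg.2 (hh.mono (hmono s hs)))
  refine ⟨hmono t ht, hgap t ht, ?_⟩
  have h1 : ∫ s in (0 : ℝ)..t, rateGap X h x y (ω, s) =
      ∫ s in (0 : ℝ)..t, (h (stateFlow X h y (ω, s)) - h (stateFlow X h x (ω, s))) := by
    refine intervalIntegral.integral_congr fun s hs => ?_
    rw [uIcc_of_le ht] at hs
    exact hgap s hs.1
  rw [h1, intervalIntegral.integral_sub (hy t ht).1 (hx t ht).1, (hx t ht).2, (hy t ht).2]
  ring

/-- Almost surely the gap stays in `[0, y - x]`. -/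
lemma ae_gap_mem (hX : IsLevyProcess X P) (hh : IsRate h α)
    (hU : ∀ x, IsStrongSolution h X P x (U x)) {x y : ℝ} (hxy : x ≤ y) :
    ∀ᵐ ω ∂P, ∀ t : ℝ, 0 ≤ t →
      0 ≤ stateFlow X h y (ω, t) - stateFlow X h x (ω, t) ∧
      stateFlow X h y (ω, t) - stateFlow X h x (ω, t) ≤ y - x := by
  filter_upwards [ae_gap_eq hX hh hU hxy] with ω hω t ht
  obtain ⟨h1, -, h2⟩ := hω t ht
  refine ⟨sub_nonneg.2 h1, ?_⟩
  have := intervalIntegral.integral_nonneg (μ := volume) ht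
    (f := fun s => rateGap X h x y (ω, s)) fun s _ => rateGap_nonneg _ _ _
  linarith

end

section
variable {X : ℝ≥0 → Ω → ℝ} {P : Measure Ω} [IsProbabilityMeasure P] {q : ℝ} {f h : ℝ → ℝ} {α : ℝ}
  {U : ℝ → ℝ≥0 → Ω → ℝ}

lemma integrable_deriv_stateFlow (hS : CostSetting X P q f) (hX : IsLevyProcess X P)
    (hh : IsRate h α) (hU : ∀ x, IsStrongSolution h X P x (U x)) (x : ℝ) :
    Integrable (fun a => deriv f (stateFlow X h x a)) (P.prod (discountMeasure q)) :=
  hS.integrable_deriv (measurable_stateFlow hX hh x).aestronglyMeasurable (abs_nonneg x)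
    hh.bound_nonneg (ae_prod_discountMeasure (R := fun ω t => |stateFlow X h x (ω, t)| ≤
      |x| + |X t.toNNReal ω| + α * |t|) (ae_stateFlow_bound hX hh hU x))

lemma integrable_cost_stateFlow (hS : CostSetting X P q f) (hX : IsLevyProcess X P)
    (hh : IsRate h α) (hU : ∀ x, IsStrongSolution h X P x (U x)) (x : ℝ) :
    Integrable (fun a => f (stateFlow X h x a)) (P.prod (discountMeasure q)) :=
  hS.integrable_cost (measurable_stateFlow hX hh x).aestronglyMeasurable (abs_nonneg x)
    hh.bound_nonneg (ae_prod_discountMeasure (R := fun ω t => |stateFlow X h x (ω, t)| ≤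
      |x| + |X t.toNNReal ω| + α * |t|) (ae_stateFlow_bound hX hh hU x))

lemma integrable_rate (hq : 0 < q) (hh : IsRate h α) {Z : Ω × ℝ → ℝ} (hZ : Measurable Z) :
    Integrable (fun a => h (Z a)) (P.prod (discountMeasure q)) := by
  have := isFiniteMeasure_discountMeasure hq
  refine (integrable_const α).mono' (hh.mono.measurable.comp hZ).aestronglyMeasurable
    (Eventually.of_forall fun a => ?_)
  rw [Real.norm_of_nonneg (hh.nonneg _)]
  exact hh.le _

/-- The renewal estimate behind the derivative formula. Control rates of the processes started at
`x` and `y` differ at time `s` only if these processes are on either side of `b`. Afterwards they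
are on either side of the process that starts at `b` at time `s`, which is independent of the
past. -/
lemma renewal_bounds (hS : CostSetting X P q f) (hX : IsLevyProcess X P)
    (hh : IsRate h α) (hU : ∀ x, IsStrongSolution h X P x (U x)) {b : ℝ}
    (hlt : ∀ z, b < z → h z = α) (hgt : ∀ z, z < b → h z = 0) {x y : ℝ} (hxy : x ≤ y) {s : ℝ}
    (hs : 0 < s) :
    ∫ a in univ ×ˢ Ioi s, rateGap X h x y (a.1, s) * deriv f (stateFlow X h x a)
        ∂P.prod (discountMeasure q) ≤
      Real.exp (-q * s) * ((∫ ω, rateGap X h x y (ω, s) ∂P) *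
        ∫ a, deriv f (stateFlow X h b a) ∂P.prod (discountMeasure q)) ∧
    Real.exp (-q * s) * ((∫ ω, rateGap X h x y (ω, s) ∂P) *
        ∫ a, deriv f (stateFlow X h b a) ∂P.prod (discountMeasure q)) ≤
      ∫ a in univ ×ˢ Ioi s, rateGap X h x y (a.1, s) * deriv f (stateFlow X h y a)
        ∂P.prod (discountMeasure q) := by
  have hmono := monotone_deriv hS.smooth hS.convex
  have hF : Measurable fun p : (ℝ≥0 → ℝ) × ℝ => deriv f (flow h b (regularize p.1) p.2) :=
    (hS.smooth.continuous_deriv le_rfl).measurable.comp (measurable_flow hh b)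
  obtain ⟨hint, heq⟩ := integral_mul_shifted hX (q := q) s.toNNReal (α := α)
    (aestronglyMeasurable_rateGap hX hh hU x y hs.le)
    (fun ω => by rw [abs_of_nonneg (rateGap_nonneg _ _ _)]; exact rateGap_le hh x y _)
    hF (integrable_deriv_stateFlow hS hX hh hU b)
  have hbdd : ∀ z : ℝ, Integrable (fun a : Ω × ℝ => rateGap X h x y (a.1, s) *
      deriv f (stateFlow X h z (a.1, s + a.2))) (P.prod (discountMeasure q)) := by
    intro z
    refine (integrable_timeShift hs.le (integrable_deriv_stateFlow hS hX hh hU z)).bdd_mul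
      (c := α) ?_ (Eventually.of_forall fun a => ?_)
    · exact ((measurable_rateGap hX hh x y).comp (by fun_prop)).aestronglyMeasurable
    · rw [Real.norm_of_nonneg (rateGap_nonneg _ _ _)]
      exact rateGap_le hh x y _
  have hsupp : ∀ᵐ ω ∂P, rateGap X h x y (ω, s) ≠ 0 →
      stateFlow X h x (ω, s) ≤ b ∧ b ≤ stateFlow X h y (ω, s) := by
    filter_upwards [ae_gap_eq hX hh hU hxy] with ω hω hne
    obtain ⟨h1, h2, -⟩ := hω s hs.le
    rw [h2] at hne
    constructor
    · by_contra hcon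
      push Not at hcon
      rw [hlt _ hcon, hlt _ (hcon.trans_le h1), sub_self] at hne
      exact hne rfl
    · by_contra hcon
      push Not at hcon
      rw [hgt _ hcon, hgt _ (h1.trans_lt hcon), sub_self] at hne
      exact hne rfl
  have hcmp : ∀ᵐ a ∂P.prod (discountMeasure q),
      rateGap X h x y (a.1, s) * deriv f (stateFlow X h x (a.1, s + a.2)) ≤
        rateGap X h x y (a.1, s) * deriv f (stateFlow (shifted X s.toNNReal) h b a) ∧
      rateGap X h x y (a.1, s) * deriv f (stateFlow (shifted X s.toNNReal) h b a) ≤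
        rateGap X h x y (a.1, s) * deriv f (stateFlow X h y (a.1, s + a.2)) := by
    refine ae_prod_discountMeasure (R := fun ω u =>
      rateGap X h x y (ω, s) * deriv f (stateFlow X h x (ω, s + u)) ≤
        rateGap X h x y (ω, s) * deriv f (stateFlow (shifted X s.toNNReal) h b (ω, u)) ∧
      rateGap X h x y (ω, s) * deriv f (stateFlow (shifted X s.toNNReal) h b (ω, u)) ≤
        rateGap X h x y (ω, s) * deriv f (stateFlow X h y (ω, s + u))) ?_
    filter_upwards [hsupp, ae_stateFlow_shift hX hh hU x b hs.le,
      ae_stateFlow_shift hX hh hU y b hs.le] with ω h0 hx hy u hu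
    by_cases hz : rateGap X h x y (ω, s) = 0
    · simp [hz]
    · obtain ⟨h1, h2⟩ := h0 hz
      exact ⟨mul_le_mul_of_nonneg_left (hmono ((hx u hu).1 h1)) (rateGap_nonneg _ _ _),
        mul_le_mul_of_nonneg_left (hmono ((hy u hu).2 h2)) (rateGap_nonneg _ _ _)⟩
  have hshift := fun z => setIntegral_timeShift P q hs.le
    (fun a => rateGap X h x y (a.1, s) * deriv f (stateFlow X h z a))
  have heq' : (∫ ω, rateGap X h x y (ω, s) ∂P) *
      ∫ a, deriv f (stateFlow X h b a) ∂P.prod (discountMeasure q) =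
      ∫ a, rateGap X h x y (a.1, s) * deriv f (stateFlow (shifted X s.toNNReal) h b a)
        ∂P.prod (discountMeasure q) := heq.symm
  rw [hshift x, hshift y, heq']
  constructor
  · refine mul_le_mul_of_nonneg_left (integral_mono_ae (hbdd x) hint ?_) (Real.exp_pos _).le
    filter_upwards [hcmp] with a ha using ha.1
  · refine mul_le_mul_of_nonneg_left (integral_mono_ae hint (hbdd y) ?_) (Real.exp_pos _).le
    filter_upwards [hcmp] with a ha using ha.2

/-- If the expected discounted marginal cost from `b` equals the unit price of control, the
increments of the cost function lie between those of its tangents at the two end points. -/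
lemma refraction_increment_bounds (hS : CostSetting X P q f) (hX : IsLevyProcess X P)
    (hh : IsRate h α) (hU : ∀ x, IsStrongSolution h X P x (U x)) {b β : ℝ}
    (hlt : ∀ z, b < z → h z = α) (hgt : ∀ z, z < b → h z = 0)
    (hβ : ∫ a, deriv f (stateFlow X h b a) ∂P.prod (discountMeasure q) = β)
    {x y : ℝ} (hxy : x < y) :
    (y - x) * ∫ a, deriv f (stateFlow X h x a) ∂P.prod (discountMeasure q) ≤
      (∫ a, f (stateFlow X h y a) + β * h (stateFlow X h y a) ∂P.prod (discountMeasure q)) -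
        ∫ a, f (stateFlow X h x a) + β * h (stateFlow X h x a) ∂P.prod (discountMeasure q) ∧
    (∫ a, f (stateFlow X h y a) + β * h (stateFlow X h y a) ∂P.prod (discountMeasure q)) -
        ∫ a, f (stateFlow X h x a) + β * h (stateFlow X h x a) ∂P.prod (discountMeasure q) ≤
      (y - x) * ∫ a, deriv f (stateFlow X h y a) ∂P.prod (discountMeasure q) := by
  have := isFiniteMeasure_discountMeasure hS.q_pos
  have hq := hS.q_pos
  have hcd := (hS.smooth.continuous_deriv le_rfl).measurable
  have hf := integrable_cost_stateFlow hS hX hh hU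
  have hd := integrable_deriv_stateFlow hS hX hh hU
  have hr := fun z => integrable_rate (P := P) hq hh (measurable_stateFlow hX hh z)
  have hgap := ae_gap_eq hX hh hU hxy.le
  have hm := measurable_rateGap hX hh x y
  have hε : ∀ᵐ ω ∂P, ∀ t : ℝ, 0 ≤ t →
      ∫ s in (0 : ℝ)..t, rateGap X h x y (ω, s) ≤ y - x := by
    filter_upwards [hgap] with ω hω t ht
    obtain ⟨h1, -, h2⟩ := hω t ht
    linarith
  have hren := fun s hs => renewal_bounds hS hX hh hU hlt hgt hxy.le (s := s) hs
  rw [hβ] at hren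
  obtain ⟨hi1, hle1⟩ := integral_mul_primitive_le hq
    (G := fun a => deriv f (stateFlow X h x a)) (hcd.comp (measurable_stateFlow hX hh x))
    (hd x) hm (rateGap_nonneg x y) (rateGap_le hh x y) hε (fun s hs => (hren s hs).1)
  -- The reverse inequality for the upper process is the same statement for `-f'` and `-β`.
  obtain ⟨hi2, hle2⟩ := integral_mul_primitive_le hq
    (G := fun a => -deriv f (stateFlow X h y a)) (c := -β)
    (hcd.comp (measurable_stateFlow hX hh y)).neg (hd y).neg hm (rateGap_nonneg x y)
    (rateGap_le hh x y) hε (fun s hs => by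
      have := (hren s hs).2
      simp only [mul_neg, integral_neg]
      linarith)
  -- The gap identities at almost every point of chance and time.
  have hgapM : ∀ᵐ a ∂P.prod (discountMeasure q),
      rateGap X h x y a = h (stateFlow X h y a) - h (stateFlow X h x a) ∧
      stateFlow X h y a - stateFlow X h x a =
        (y - x) - ∫ s in (0 : ℝ)..a.2, rateGap X h x y (a.1, s) := by
    refine ae_prod_discountMeasure (R := fun ω t =>
      rateGap X h x y (ω, t) = h (stateFlow X h y (ω, t)) - h (stateFlow X h x (ω, t)) ∧
      stateFlow X h y (ω, t) - stateFlow X h x (ω, t) =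
        (y - x) - ∫ s in (0 : ℝ)..t, rateGap X h x y (ω, s)) ?_
    filter_upwards [hgap] with ω hω t ht using (hω t ht).2
  have hmi : Integrable (rateGap X h x y) (P.prod (discountMeasure q)) :=
    ((hr y).sub (hr x)).congr (by
      filter_upwards [hgapM] with a ha
      exact ha.1.symm)
  have hcost : ∀ z, Integrable (fun a => f (stateFlow X h z a) + β * h (stateFlow X h z a))
      (P.prod (discountMeasure q)) := fun z => (hf z).add ((hr z).const_mul β)
  have hdiff : (∫ a, f (stateFlow X h y a) + β * h (stateFlow X h y a)
        ∂P.prod (discountMeasure q)) -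
        ∫ a, f (stateFlow X h x a) + β * h (stateFlow X h x a) ∂P.prod (discountMeasure q) =
      ∫ a, (f (stateFlow X h y a) - f (stateFlow X h x a)) + β * rateGap X h x y a
        ∂P.prod (discountMeasure q) := by
    rw [← integral_sub (hcost y) (hcost x)]
    refine integral_congr_ae ?_
    filter_upwards [hgapM] with a ha
    rw [ha.1]
    ring
  have hdi : Integrable (fun a => (f (stateFlow X h y a) - f (stateFlow X h x a)) +
      β * rateGap X h x y a) (P.prod (discountMeasure q)) :=
    ((hf y).sub (hf x)).add (hmi.const_mul β)
  rw [hdiff]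
  constructor
  · have hlow : (y - x) * ∫ a, deriv f (stateFlow X h x a) ∂P.prod (discountMeasure q) -
        (∫ a, deriv f (stateFlow X h x a) *
          (∫ s in (0 : ℝ)..a.2, rateGap X h x y (a.1, s)) ∂P.prod (discountMeasure q)) +
        β * ∫ a, rateGap X h x y a ∂P.prod (discountMeasure q) ≤
        ∫ a, (f (stateFlow X h y a) - f (stateFlow X h x a)) + β * rateGap X h x y a
          ∂P.prod (discountMeasure q) := by
      have hA : Integrable (fun a => (y - x) * deriv f (stateFlow X h x a) -
          deriv f (stateFlow X h x a) * ∫ s in (0 : ℝ)..a.2, rateGap X h x y (a.1, s))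
          (P.prod (discountMeasure q)) := ((hd x).const_mul _).sub hi1
      rw [← integral_const_mul, ← integral_const_mul, ← integral_sub ((hd x).const_mul _) hi1,
        ← integral_add hA (hmi.const_mul β)]
      refine integral_mono_ae (hA.add (hmi.const_mul β)) hdi ?_
      filter_upwards [hgapM] with a ha
      -- The tangent at the lower process, applied to the gap `(y - x) - ∫ rateGap`.
      have h1 := tangent_le hS.smooth hS.convex (stateFlow X h x a) (stateFlow X h y a)
      rw [ha.2] at h1
      linarith
    linarith
  · have hhigh : ∫ a, (f (stateFlow X h y a) - f (stateFlow X h x a)) + β * rateGap X h x y a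
          ∂P.prod (discountMeasure q) ≤
        (y - x) * ∫ a, deriv f (stateFlow X h y a) ∂P.prod (discountMeasure q) +
        (∫ a, -deriv f (stateFlow X h y a) *
          (∫ s in (0 : ℝ)..a.2, rateGap X h x y (a.1, s)) ∂P.prod (discountMeasure q)) +
        β * ∫ a, rateGap X h x y a ∂P.prod (discountMeasure q) := by
      have hA : Integrable (fun a => (y - x) * deriv f (stateFlow X h y a) +
          -deriv f (stateFlow X h y a) * ∫ s in (0 : ℝ)..a.2, rateGap X h x y (a.1, s))
          (P.prod (discountMeasure q)) := ((hd y).const_mul _).add hi2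
      rw [← integral_const_mul, ← integral_const_mul, ← integral_add ((hd y).const_mul _) hi2,
        ← integral_add hA (hmi.const_mul β)]
      refine integral_mono_ae hdi (hA.add (hmi.const_mul β)) ?_
      filter_upwards [hgapM] with a ha
      have h1 := tangent_le hS.smooth hS.convex (stateFlow X h y a) (stateFlow X h x a)
      have h2 : stateFlow X h x a - stateFlow X h y a =
          -((y - x) - ∫ s in (0 : ℝ)..a.2, rateGap X h x y (a.1, s)) := by
        rw [← ha.2]; ring
      rw [h2] at h1
      linarith
    linarith

end

end

/-! ### The threshold `b*` -/

section

variable {Ω : Type*} [MeasurableSpace Ω]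
variable {X : ℝ≥0 → Ω → ℝ} {P : Measure Ω} [IsProbabilityMeasure P] {γ : ℝ} {ν : Measure ℝ}
  {q α β : ℝ} {f : ℝ → ℝ} {U : ℝ → ℝ → ℝ≥0 → Ω → ℝ}

/-- At a finite infimum of the superlevel set of a continuous monotone function, the level is
attained. -/
lemma eq_of_sInf_coe_eq {ρ : ℝ → ℝ} (hcont : Continuous ρ) (hmono : Monotone ρ) {β r : ℝ}
    (hr : sInf ((fun b : ℝ => (b : EReal)) '' {b : ℝ | 0 ≤ ρ b - β}) = (r : EReal)) : ρ r = β := by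
  have hlow : ∀ c, c < r → ρ c ≤ β := by
    intro c hc
    by_contra hlt
    have h1 : (r : EReal) ≤ c := hr ▸ sInf_le ⟨c, by simpa using (not_le.1 hlt).le, rfl⟩
    exact absurd (EReal.coe_le_coe_iff.1 h1) (not_le.2 hc)
  have hhigh : ∀ c, r < c → β ≤ ρ c := by
    intro c hc
    have h1 : sInf ((fun b : ℝ => (b : EReal)) '' {b : ℝ | 0 ≤ ρ b - β}) < (c : EReal) := by
      rw [hr]
      exact EReal.coe_lt_coe_iff.2 hc
    obtain ⟨-, ⟨d, hd, rfl⟩, hdc⟩ := sInf_lt_iff.1 h1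
    have h2 := hmono (EReal.coe_lt_coe_iff.1 hdc).le
    have h3 : 0 ≤ ρ d - β := hd
    linarith
  refine le_antisymm ?_ ?_
  · refine le_of_tendsto (f := ρ) (x := 𝓝[<] r) (hcont.continuousAt.mono_left nhdsWithin_le_nhds) ?_
    filter_upwards [self_mem_nhdsWithin] with c hc using hlow c hc
  · refine ge_of_tendsto (f := ρ) (x := 𝓝[>] r) (hcont.continuousAt.mono_left nhdsWithin_le_nhds) ?_
    filter_upwards [self_mem_nhdsWithin] with c hc using hhigh c hc

/-- Refraction does not increase the distance between two starting points. -/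
lemma abs_stateFlow_sub_le (hX : IsLevyProcess X P) {h : ℝ → ℝ} (hh : IsRate h α)
    {V : ℝ → ℝ≥0 → Ω → ℝ} (hV : ∀ x, IsStrongSolution h X P x (V x)) (x y : ℝ) :
    ∀ᵐ a ∂P.prod (discountMeasure q), |stateFlow X h y a - stateFlow X h x a| ≤ |y - x| := by
  refine ae_prod_discountMeasure
    (R := fun ω t => |stateFlow X h y (ω, t) - stateFlow X h x (ω, t)| ≤ |y - x|) ?_
  rcases le_total x y with hxy | hxy
  · filter_upwards [ae_gap_mem hX hh hV hxy] with ω hω t ht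
    rw [abs_of_nonneg (hω t ht).1, abs_of_nonneg (sub_nonneg.2 hxy)]
    exact (hω t ht).2
  · filter_upwards [ae_gap_mem hX hh hV hxy] with ω hω t ht
    rw [abs_sub_comm, abs_sub_comm y, abs_of_nonneg (hω t ht).1, abs_of_nonneg (sub_nonneg.2 hxy)]
    exact (hω t ht).2

/-- `ρ(b)` as an integral of the joint flow, first of the process refracted at `b`, then of the
translate of the process refracted at `0`, in which `b` enters only as a summand. -/
lemma rho_eq_integral_translate (hS : CostSetting X P q f) (hX : IsLevyProcess X P) (hα : 0 ≤ α)
    (hU : ∀ b x : ℝ, IsStrongSolution (refractionRate X P γ ν α b) X P x (U b x)) (b : ℝ) :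
    rho P q f U b = ∫ a, deriv f (stateFlow X (refractionRate X P γ ν α b) b a)
        ∂P.prod (discountMeasure q) ∧
      rho P q f U b = ∫ a, deriv f (stateFlow X (refractionRate X P γ ν α 0) 0 a + b)
        ∂P.prod (discountMeasure q) := by
  have hb := isRate_refractionRate X P γ ν hα b
  have h0 := isRate_refractionRate X P γ ν hα 0
  have h1 : ∀ᵐ a ∂P.prod (discountMeasure q), U b b a.2.toNNReal a.1 =
      stateFlow X (refractionRate X P γ ν α b) b a :=
    ae_prod_discountMeasure (R := fun ω t => U b b t.toNNReal ω =
      stateFlow X (refractionRate X P γ ν α b) b (ω, t)) (ae_eq_stateFlow hX hb (hU b b))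
  have h2 : ∀ᵐ a ∂P.prod (discountMeasure q), U b b a.2.toNNReal a.1 =
      stateFlow X (refractionRate X P γ ν α 0) 0 a + b := by
    refine ae_prod_discountMeasure (R := fun ω t => U b b t.toNNReal ω =
      stateFlow X (refractionRate X P γ ν α 0) 0 (ω, t) + b) ?_
    filter_upwards [ae_eq_stateFlow hX h0 (hU 0 0), ae_stateFlow_translate hX hα hU b]
      with ω e1 e2 t ht
    rw [e2 t ht, e1 t ht]
  have h3 : Integrable (fun a : Ω × ℝ => deriv f (U b b a.2.toNNReal a.1))
      (P.prod (discountMeasure q)) := by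
    refine (integrable_deriv_stateFlow hS hX hb (hU b) b).congr ?_
    filter_upwards [h1] with a ha
    rw [ha]
  have h4 : rho P q f U b = ∫ a : Ω × ℝ, deriv f (U b b a.2.toNNReal a.1)
      ∂P.prod (discountMeasure q) := discounted_eq h3
  rw [h4]
  constructor
  · refine integral_congr_ae ?_
    filter_upwards [h1] with a ha
    rw [ha]
  · refine integral_congr_ae ?_
    filter_upwards [h2] with a ha
    rw [ha]

/-- At a finite threshold `b*` the expected discounted marginal cost is the unit price of
control. -/
lemma rho_bStar (hS : CostSetting X P q f) (hX : IsLevyProcess X P) (hα : 0 ≤ α)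
    (hU : ∀ b x : ℝ, IsStrongSolution (refractionRate X P γ ν α b) X P x (U b x)) {r : ℝ}
    (hr : bStar P q β f U = (r : EReal)) : rho P q f U r = β := by
  have h0 := isRate_refractionRate X P γ ν hα 0
  have hm := (measurable_stateFlow hX h0 0).aestronglyMeasurable (μ := P.prod (discountMeasure q))
  have hb : ∀ x, ∀ᵐ a ∂P.prod (discountMeasure q),
      |stateFlow X (refractionRate X P γ ν α 0) 0 a + x| ≤
        |x| + |X a.2.toNNReal a.1| + α * |a.2| := by
    intro x
    refine ae_prod_discountMeasure (R := fun ω t =>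
      |stateFlow X (refractionRate X P γ ν α 0) 0 (ω, t) + x| ≤
        |x| + |X t.toNNReal ω| + α * |t|) ?_
    filter_upwards [ae_stateFlow_bound hX h0 (hU 0) 0] with ω hω t ht
    have := hω t ht
    rw [abs_zero, zero_add] at this
    linarith [abs_add_le (stateFlow X (refractionRate X P γ ν α 0) 0 (ω, t)) x]
  refine eq_of_sInf_coe_eq ?_ ?_ hr
  · have := hS.continuous_integral_deriv (fun x => hm.add_const x) hα hb
      (fun x y => Eventually.of_forall fun a => by simp)
    refine this.congr fun x => ?_
    rw [(rho_eq_integral_translate hS hX hα hU x).2]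
  · intro x y hxy
    rw [(rho_eq_integral_translate hS hX hα hU x).2, (rho_eq_integral_translate hS hX hα hU y).2]
    refine integral_mono (hS.integrable_deriv (hm.add_const x) (abs_nonneg x) hα (hb x))
      (hS.integrable_deriv (hm.add_const y) (abs_nonneg y) hα (hb y)) fun a => ?_
    exact monotone_deriv hS.smooth hS.convex (by linarith)

/-! ### Convexity and smoothness of the cost function -/

/-- The conclusion for any family of controlled processes whose cost has increments between the
tangent increments at the two end points. -/
lemma convex_contDiff_of_discounted {Z L : ℝ → ℝ≥0 → Ω → ℝ} {v : ℝ → ℝ}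
    (hv : ∀ x, v x = discounted P q fun t ω => f (Z x t ω) + β * L x t ω)
    (hcost : ∀ x, Integrable (fun a : Ω × ℝ => f (Z x a.2.toNNReal a.1) +
      β * L x a.2.toNNReal a.1) (P.prod (discountMeasure q)))
    (hder : ∀ x, Integrable (fun a : Ω × ℝ => deriv f (Z x a.2.toNNReal a.1))
      (P.prod (discountMeasure q)))
    (hcont : Continuous fun x => ∫ a : Ω × ℝ, deriv f (Z x a.2.toNNReal a.1)
      ∂P.prod (discountMeasure q))
    (hinc : ∀ x y, x < y →
      (y - x) * ∫ a : Ω × ℝ, deriv f (Z x a.2.toNNReal a.1) ∂P.prod (discountMeasure q) ≤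
        (∫ a : Ω × ℝ, f (Z y a.2.toNNReal a.1) + β * L y a.2.toNNReal a.1
          ∂P.prod (discountMeasure q)) -
        ∫ a : Ω × ℝ, f (Z x a.2.toNNReal a.1) + β * L x a.2.toNNReal a.1
          ∂P.prod (discountMeasure q) ∧
      (∫ a : Ω × ℝ, f (Z y a.2.toNNReal a.1) + β * L y a.2.toNNReal a.1
          ∂P.prod (discountMeasure q)) -
        ∫ a : Ω × ℝ, f (Z x a.2.toNNReal a.1) + β * L x a.2.toNNReal a.1
          ∂P.prod (discountMeasure q) ≤
      (y - x) * ∫ a : Ω × ℝ, deriv f (Z y a.2.toNNReal a.1) ∂P.prod (discountMeasure q)) :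
    ConvexOn ℝ univ v ∧ ContDiff ℝ 1 v ∧
    ∀ x : ℝ, DiscountedIntegrable P q (fun t ω => f (Z x t ω) + β * L x t ω) ∧
      DiscountedIntegrable P q (fun t ω => deriv f (Z x t ω)) ∧
      HasDerivAt v (discounted P q fun t ω => deriv f (Z x t ω)) x := by
  have hv' : ∀ x, v x = ∫ a : Ω × ℝ, f (Z x a.2.toNNReal a.1) + β * L x a.2.toNNReal a.1
      ∂P.prod (discountMeasure q) := fun x => (hv x).trans (discounted_eq (hcost x))
  obtain ⟨h1, h2, h3⟩ := convex_contDiff_of_increment_bounds (v := v) hcont (fun x y hxy => by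
    rw [hv' x, hv' y]
    exact hinc x y hxy)
  refine ⟨h1, h2, fun x => ⟨discountedIntegrable_iff.2 (hcost x),
    discountedIntegrable_iff.2 (hder x), ?_⟩⟩
  rw [discounted_eq (hder x)]
  exact h3 x

/-- A control that does not depend on the starting point translates the cost, so that its cost
function inherits the convexity of `f`. -/
lemma convex_contDiff_of_constant_rate (hS : CostSetting X P q f) (hX : IsLevyProcess X P)
    {c l : ℝ} (hc : 0 ≤ c) {v : ℝ → ℝ}
    (hv : ∀ x, v x = discounted P q fun t ω => f (x + X t ω - c * t) + β * l) :
    ConvexOn ℝ univ v ∧ ContDiff ℝ 1 v ∧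
    ∀ x : ℝ, DiscountedIntegrable P q (fun t ω => f (x + X t ω - c * t) + β * l) ∧
      DiscountedIntegrable P q (fun t ω => deriv f (x + X t ω - c * t)) ∧
      HasDerivAt v (discounted P q fun t ω => deriv f (x + X t ω - c * t)) x := by
  have := isFiniteMeasure_discountMeasure hS.q_pos
  have hZ : ∀ x, AEStronglyMeasurable
      (fun a : Ω × ℝ => x + X a.2.toNNReal a.1 - c * (a.2.toNNReal : ℝ))
      (P.prod (discountMeasure q)) := by
    intro x
    have hm : Measurable fun a : Ω × ℝ =>
        x + regularize (fun s => X s a.1) a.2 - c * (a.2.toNNReal : ℝ) :=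
      (hX.measurable_regularize_path.const_add x).sub (by fun_prop)
    refine hm.aestronglyMeasurable.congr ?_
    refine ae_prod_discountMeasure (R := fun ω t =>
      x + regularize (fun s => X s ω) t - c * (t.toNNReal : ℝ) =
        x + X t.toNNReal ω - c * (t.toNNReal : ℝ)) ?_
    filter_upwards [hX.ae_regularize_eq] with ω hω t ht
    rw [hω t ht]
  have hb : ∀ x, ∀ᵐ a ∂P.prod (discountMeasure q),
      |x + X a.2.toNNReal a.1 - c * (a.2.toNNReal : ℝ)| ≤
        |x| + |X a.2.toNNReal a.1| + c * |a.2| := by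
    intro x
    refine ae_prod_discountMeasure (R := fun ω t =>
      |x + X t.toNNReal ω - c * (t.toNNReal : ℝ)| ≤ |x| + |X t.toNNReal ω| + c * |t|)
      (Eventually.of_forall fun ω t ht => ?_)
    rw [Real.coe_toNNReal _ ht, abs_of_nonneg ht]
    refine (abs_sub _ _).trans ?_
    rw [abs_of_nonneg (mul_nonneg hc ht)]
    linarith [abs_add_le x (X t.toNNReal ω)]
  have hf := fun x => hS.integrable_cost (hZ x) (abs_nonneg x) hc (hb x)
  have hd := fun x => hS.integrable_deriv (hZ x) (abs_nonneg x) hc (hb x)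
  refine convex_contDiff_of_discounted (Z := fun x t ω => x + X t ω - c * t)
    (L := fun _ _ _ => l) hv (fun x => (hf x).add (integrable_const _)) hd
    (hS.continuous_integral_deriv hZ hc hb fun x y => Eventually.of_forall fun a => le_of_eq ?_)
    fun x y _ => ?_
  · congr 1
    ring
  · simp only [integral_add (hf _) (integrable_const (β * l)), add_sub_add_right_eq_sub]
    rw [← integral_sub (hf y) (hf x), ← integral_const_mul, ← integral_const_mul]
    constructor
    · refine integral_mono ((hd x).const_mul _) ((hf y).sub (hf x)) fun a => ?_
      have := tangent_le hS.smooth hS.convex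
        (x + X a.2.toNNReal a.1 - c * (a.2.toNNReal : ℝ))
        (y + X a.2.toNNReal a.1 - c * (a.2.toNNReal : ℝ))
      dsimp only
      linarith
    · refine integral_mono ((hf y).sub (hf x)) ((hd y).const_mul _) fun a => ?_
      have := tangent_le hS.smooth hS.convex
        (y + X a.2.toNNReal a.1 - c * (a.2.toNNReal : ℝ))
        (x + X a.2.toNNReal a.1 - c * (a.2.toNNReal : ℝ))
      dsimp only
      linarith

/-- The cost function of refraction at `b` is convex and continuously differentiable if the expected
discounted marginal cost from `b` is the unit price `β` of control. -/
lemma convex_contDiff_of_refraction (hS : CostSetting X P q f) (hX : IsLevyProcess X P)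
    {h : ℝ → ℝ} (hh : IsRate h α) {V : ℝ → ℝ≥0 → Ω → ℝ}
    (hV : ∀ x, IsStrongSolution h X P x (V x)) {b : ℝ}
    (hlt : ∀ z, b < z → h z = α) (hgt : ∀ z, z < b → h z = 0)
    (hβ : ∫ a, deriv f (stateFlow X h b a) ∂P.prod (discountMeasure q) = β) {v : ℝ → ℝ}
    (hv : ∀ x, v x = discounted P q fun t ω => f (V x t ω) + β * h (V x t ω)) :
    ConvexOn ℝ univ v ∧ ContDiff ℝ 1 v ∧
    ∀ x : ℝ, DiscountedIntegrable P q (fun t ω => f (V x t ω) + β * h (V x t ω)) ∧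
      DiscountedIntegrable P q (fun t ω => deriv f (V x t ω)) ∧
      HasDerivAt v (discounted P q fun t ω => deriv f (V x t ω)) x := by
  have heq : ∀ x, ∀ᵐ a ∂P.prod (discountMeasure q),
      V x a.2.toNNReal a.1 = stateFlow X h x a := fun x =>
    ae_prod_discountMeasure (R := fun ω t => V x t.toNNReal ω = stateFlow X h x (ω, t))
      (ae_eq_stateFlow hX hh (hV x))
  have hcost : ∀ x, (fun a : Ω × ℝ => f (stateFlow X h x a) + β * h (stateFlow X h x a))
      =ᵐ[P.prod (discountMeasure q)]
      fun a => f (V x a.2.toNNReal a.1) + β * h (V x a.2.toNNReal a.1) := fun x => by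
    filter_upwards [heq x] with a ha
    rw [ha]
  have hder : ∀ x, (fun a : Ω × ℝ => deriv f (stateFlow X h x a))
      =ᵐ[P.prod (discountMeasure q)] fun a => deriv f (V x a.2.toNNReal a.1) := fun x => by
    filter_upwards [heq x] with a ha
    rw [ha]
  refine convex_contDiff_of_discounted (Z := V) (L := fun x t ω => h (V x t ω)) hv
    (fun x => Integrable.congr ((integrable_cost_stateFlow hS hX hh hV x).add
      ((integrable_rate hS.q_pos hh (measurable_stateFlow hX hh x)).const_mul β)) (hcost x))
    (fun x => (integrable_deriv_stateFlow hS hX hh hV x).congr (hder x)) ?_ fun x y hxy => ?_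
  · refine (hS.continuous_integral_deriv
      (fun x => (measurable_stateFlow hX hh x).aestronglyMeasurable) hh.bound_nonneg (fun x =>
        ae_prod_discountMeasure (R := fun ω t => |stateFlow X h x (ω, t)| ≤
          |x| + |X t.toNNReal ω| + α * |t|) (ae_stateFlow_bound hX hh hV x))
      (abs_stateFlow_sub_le hX hh hV)).congr fun x => integral_congr_ae (hder x)
  · rw [← integral_congr_ae (hcost x), ← integral_congr_ae (hcost y),
      ← integral_congr_ae (hder x), ← integral_congr_ae (hder y)]
    exact refraction_increment_bounds hS hX hh hV hlt hgt hβ hxy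

end

end RefractedLevy

theorem theorem4p1 {Ω : Type*} [MeasurableSpace Ω] (P : Measure Ω) [IsProbabilityMeasure P]
    (X : ℝ≥0 → Ω → ℝ) (γ σ : ℝ) (ν : Measure ℝ) (q α β : ℝ) (f : ℝ → ℝ)
    (U : ℝ → ℝ → ℝ≥0 → Ω → ℝ)
    (hX : IsLevyProcess X P) (htriplet : HasLevyTriplet X P γ σ ν)
    (hexp : ∃ θ : ℝ, 0 < θ ∧
      ∫⁻ z in (Ioo (-1 : ℝ) 1)ᶜ, ENNReal.ofReal (Real.exp (θ * |z|)) ∂ν < ∞)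
    (hq : 0 < q) (hα : 0 < α)
    (hf_smooth : ContDiff ℝ 1 f) (hf_convex : ConvexOn ℝ univ f)
    (hf_growth : ∃ k₁ k₂ : ℝ, ∃ N : ℕ, 0 < k₁ ∧ 0 < k₂ ∧ ∀ x, |f x| < k₁ + k₂ * |x| ^ N)
    (hU : ∀ b x : ℝ, IsUniqueStrongSolution (refractionRate X P γ ν α b) X P x (U b x)) :
    let b : EReal := bStar P q β f U
    let v : ℝ → ℝ := costFunction X P γ ν q α β f U b
    ConvexOn ℝ univ v ∧ ContDiff ℝ 1 v ∧
    (∀ x : ℝ,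
      DiscountedIntegrable P q (costRate X P γ ν α β f U b x) ∧
      DiscountedIntegrable P q (fun t ω => deriv f (controlled X α U b x t ω)) ∧
      HasDerivAt v (discounted P q fun t ω => deriv f (controlled X α U b x t ω)) x) ∧
    (b = ⊤ → ∀ x : ℝ, v x = discounted P q (fun t ω => f (x + X t ω)) ∧
      HasDerivAt v (discounted P q fun t ω => deriv f (x + X t ω)) x) ∧
    (b = ⊥ → ∀ x : ℝ, v x = discounted P q (fun t ω => f (x + X t ω - α * t) + β * α) ∧
      HasDerivAt v (discounted P q fun t ω => deriv f (x + X t ω - α * t)) x) := by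
  intro b v
  have hS : CostSetting X P q f := by
    refine ⟨hq, integrable_pow_levy hX htriplet hexp hq, hf_smooth, hf_convex, ?_⟩
    obtain ⟨k₁, k₂, N, -, hk₂, hb⟩ := hf_growth
    exact ⟨k₁, k₂, N, hk₂.le, fun x => (hb x).le⟩
  have hU' := fun b x => (hU b x).isStrongSolution
  by_cases htop : b = ⊤
  · have hctrl : ∀ x, controlled X α U b x = fun t ω => x + X t ω := by
      intro x; funext t ω; simp [controlled, htop]
    have hrate : ∀ x, costRate X P γ ν α β f U b x = fun t ω => f (x + X t ω) := by
      intro x; funext t ω; rw [costRate, hctrl]; simp [controlRate, htop]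
    have hv : ∀ x, v x = discounted P q (fun t ω => f (x + X t ω)) := fun x => by
      simp only [v, costFunction, hrate]
    have key := convex_contDiff_of_constant_rate (β := β) (c := 0) (l := 0) hS hX le_rfl
      (v := v) (fun x => by simp [hv])
    simp only [zero_mul, sub_zero, mul_zero, add_zero] at key
    obtain ⟨h1, h2, h3⟩ := key
    refine ⟨h1, h2, fun x => ?_, fun _ x => ⟨hv x, (h3 x).2.2⟩, fun h => ?_⟩
    · simp only [hrate, hctrl]
      exact h3 x
    · exact absurd (htop.symm.trans h) (by simp)
  by_cases hbot : b = ⊥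
  · have hctrl : ∀ x, controlled X α U b x = fun t ω => x + X t ω - α * t := by
      intro x; funext t ω; simp [controlled, hbot]
    have hrate : ∀ x, costRate X P γ ν α β f U b x =
        fun t ω => f (x + X t ω - α * t) + β * α := by
      intro x; funext t ω; rw [costRate, hctrl]; simp [controlRate, hbot]
    have hv : ∀ x, v x = discounted P q (fun t ω => f (x + X t ω - α * t) + β * α) := fun x => by
      simp only [v, costFunction, hrate]
    obtain ⟨h1, h2, h3⟩ := convex_contDiff_of_constant_rate hS hX hα.le (v := v) hv
    refine ⟨h1, h2, fun x => ?_, fun h => absurd h htop, fun _ x => ⟨hv x, (h3 x).2.2⟩⟩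
    simp only [hrate, hctrl]
    exact h3 x
  · obtain ⟨r, hr⟩ : ∃ r : ℝ, b = (r : EReal) := ⟨b.toReal, (EReal.coe_toReal htop hbot).symm⟩
    have hctrl : ∀ x, controlled X α U b x = U r x := by
      intro x; funext t ω; simp [controlled, hr]
    have hrate : ∀ x, costRate X P γ ν α β f U b x =
        fun t ω => f (U r x t ω) + β * refractionRate X P γ ν α r (U r x t ω) := by
      intro x; funext t ω; rw [costRate, hctrl]; simp [controlRate, hr]
    obtain ⟨h1, h2, h3⟩ := convex_contDiff_of_refraction hS hX
      (isRate_refractionRate X P γ ν hα.le r) (hU' r) (v := v)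
      (fun z => refractionRate_of_lt) (fun z => refractionRate_of_gt)
      ((rho_eq_integral_translate hS hX hα.le hU' r).1.symm.trans (rho_bStar hS hX hα.le hU' hr))
      (fun x => by simp only [v, costFunction, hrate])
    refine ⟨h1, h2, fun x => ?_, fun h => absurd h htop, fun h => absurd h hbot⟩
    simp only [hrate, hctrl]
    exact h3 x
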